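/- Let $(X,\mu)$ be a measure space, $\mathcal H=L^2(X,\mu)$ (complex valued, with $\langle g|h\rangle=\int\bar g\,h\,d\mu$), and let $\omega:X\to\mathbb R$ be measurable with $\omega\ge 1$ almost everywhere; $\omega$ also denotes the self-adjoint operator of multiplication by $\omega$ in $\mathcal H$. Let $f:X\to\mathbb C$ be a function such that $$\omega^{-1/2}f\notin\mathcal H\qquad\text{and}\qquad \omega^{-3/2}f\in\mathcal H ,$$ let $\lambda<0$, and for $n\in\mathbb N$ put $f_n=\mathbf 1_{\omega\le n}f$ and define $\lambda_n\in\mathbb R$ by $$\lambda_n^{-1}=\lambda^{-1}-4\langle f_n|\omega^{-1}f_n\rangle .$$ (i) For every $n$ one has $\omega^{1/2}f_n\in\mathcal H$, and the operator $\omega^2+4\lambda_n|\omega^{1/2}f_n\rangle\langle\omega^{1/2}f_n|$ with domain $D(\omega^2)$ has a unique positive self-adjoint square root, which is denoted by $\xi_{\lambda_n,n}$. (ii) There is a (necessarily unique) self-adjoint operator in $\mathcal H$ whose resolvent at every $z\in\mathbb C\setminus\mathbb R$ is $$(\omega^2-z)^{-1}-\frac{4\lambda}{1+4\lambda z\langle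 f|\omega^{-1}(\omega^2-z)^{-1}f\rangle}\;\omega^{1/2}(\omega^2-z)^{-1}|f\rangle\langle f|\,\omega^{1/2}(\omega^2-z)^{-1},$$ where $\langle f|\cdot\rangle$ denotes the integral $\int\bar f\,(\cdot)\,d\mu$. This operator has a unique positive self-adjoint square root, which is denoted by $\xi_\lambda$. (iii) Let $\mathcal F=\bigoplus_{n\ge0}\mathcal H^{\otimes_s n}$ be the bosonic Fock space over $\mathcal H$, and for a positive self-adjoint operator $A$ in $\mathcal H$ let $d\Gamma(A)$ be the Friedrichs extension of $\bigoplus_n\sum_{i=1}^n A_i$ (with $A_i$ acting on the $i$-th tensor factor), defined on $\bigcup_N\bigoplus_{n\le N}D(A)^{\otimes_s n}$. Then $d\Gamma(\xi_{\lambda_n,n})\to d\Gamma(\xi_\lambda)$ in the norm resolvent sense: these operators are self-adjoint, and for every $z\in\mathbb C\setminus\mathbb R$ $$\big\|(d\Gamma(\xi_{\lambda_n,n})-z)^{-1}-(d\Gamma(\xi_\lambda)-z)^{-1}\big\|\longrightarrow0\qquad(n\to\infty).$$ -/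

import Mathlib

open MeasureTheory Filter Topology
open scoped TensorProduct ComplexConjugate

noncomputable section

namespace QuadBose

universe u

/-! ## Unbounded operators on a complex Hilbert space -/

section Operators

variable {E : Type u} [NormedAddCommGroup E] [InnerProductSpace ℂ E]

/-- `R` is the resolvent `(A - z)⁻¹` of the (unbounded) operator `A` at the point `z`: a bounded
operator with values in the domain of `A`, which is a two-sided inverse of `A - z`. -/
def IsResolventAt (A : E →ₗ.[ℂ] E) (z : ℂ) (R : E →L[ℂ] E) : Prop :=
  (∀ y : E, ∃ h : R y ∈ A.domain, A ⟨R y, h⟩ - z • R y = y) ∧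
    ∀ x : A.domain, R (A x - z • (x : E)) = x

/-- `T` is a positive self-adjoint square root of `A`: it is self-adjoint, its quadratic form is
nonnegative, and `T ∘ T = A` as operators, with the domain
`D(T ∘ T) = {x ∈ D(T) | T x ∈ D(T)}`. -/
def IsPositiveSqrt [CompleteSpace E] (T A : E →ₗ.[ℂ] E) : Prop :=
  IsSelfAdjoint T ∧ (∀ x : T.domain, 0 ≤ (inner ℂ (x : E) (T x)).re) ∧
    ∀ x z : E, (x, z) ∈ A.graph ↔ ∃ y : E, (x, y) ∈ T.graph ∧ (y, z) ∈ T.graph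

/-- Convergence in the norm resolvent sense of a sequence of self-adjoint operators to a
self-adjoint operator: for every `z ∈ ℂ \ ℝ` the resolvents at `z` converge in operator norm. -/
structure NormResolventTendsto [CompleteSpace E]
    (A : ℕ → E →ₗ.[ℂ] E) (B : E →ₗ.[ℂ] E) : Prop where
  selfAdjoint_seq : ∀ n, IsSelfAdjoint (A n)
  selfAdjoint_lim : IsSelfAdjoint B
  tendsto_resolvent : ∀ z : ℂ, z.im ≠ 0 → ∃ (R : ℕ → E →L[ℂ] E) (S : E →L[ℂ] E),
    (∀ n, IsResolventAt (A n) z (R n)) ∧ IsResolventAt B z S ∧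
      Tendsto (fun n => ‖R n - S‖) atTop (𝓝 0)

/-- The domain of the closure of the quadratic form `x ↦ ⟪x, S x⟫` of a positive symmetric
operator `S`: the limits of the sequences in `D(S)` that converge in the Hilbert space and are
Cauchy for the form. (For positive symmetric `S` these limits already form a subspace, so that
taking the span adds nothing.) -/
def formDomain (S : E →ₗ.[ℂ] E) : Submodule ℂ E :=
  Submodule.span ℂ {x : E | ∃ v : ℕ → S.domain,
    Tendsto (fun k => (v k : E)) atTop (𝓝 x) ∧
    ∀ ε > 0, ∃ N, ∀ k ≥ N, ∀ l ≥ N,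
      ‖(inner ℂ ((v k - v l : S.domain) : E) (S (v k - v l)) : ℂ)‖ < ε}

/-- The Friedrichs extension of a densely defined positive symmetric operator `S`: the
restriction of the adjoint `S†` to `D(S†)` intersected with the domain of the closed form. -/
def friedrichs [CompleteSpace E] (S : E →ₗ.[ℂ] E) : E →ₗ.[ℂ] E :=
  S.adjoint.domRestrict (formDomain S)

end Operators

/-! ## The bosonic Fock space -/

/-- A bundled complex inner product space. -/
structure InnerSpace where
  carrier : Type u
  [normed : NormedAddCommGroup carrier]
  [inner : InnerProductSpace ℂ carrier]

/-- The algebraic tensor powers `H^{⊗ 0} = ℂ`, `H^{⊗ (n+1)} = H ⊗ H^{⊗ n}`, with the inner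
product determined by `⟪u₁ ⊗ ⋯ ⊗ uₙ, v₁ ⊗ ⋯ ⊗ vₙ⟫ = ∏ ⟪uᵢ, vᵢ⟫`. (`EuclideanSpace ℂ PUnit` is the
one-dimensional space `ℂ`, placed in the universe of `H`.) -/
def tensorPowBundle (H : Type u) [NormedAddCommGroup H] [InnerProductSpace ℂ H] :
    ℕ → InnerSpace.{u}
  | 0 => ⟨EuclideanSpace ℂ PUnit.{u + 1}⟩
  | n + 1 =>
    letI := (tensorPowBundle H n).normed
    letI := (tensorPowBundle H n).inner
    ⟨H ⊗[ℂ] (tensorPowBundle H n).carrier⟩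

section Fock

variable (H : Type u) [NormedAddCommGroup H] [InnerProductSpace ℂ H]

/-- The `n`-th algebraic tensor power of `H`, as an inner product space. -/
def TensorPow (n : ℕ) : Type u := (tensorPowBundle H n).carrier

instance (n : ℕ) : NormedAddCommGroup (TensorPow H n) := (tensorPowBundle H n).normed

instance (n : ℕ) : InnerProductSpace ℂ (TensorPow H n) := (tensorPowBundle H n).inner

variable {H}

/-- The product tensor `u₁ ⊗ ⋯ ⊗ uₙ`. -/
def tprod : (n : ℕ) → (Fin n → H) → TensorPow H n
  | 0, _ => (EuclideanSpace.single PUnit.unit (1 : ℂ) : EuclideanSpace ℂ PUnit.{u + 1})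
  | n + 1, v => (v 0 ⊗ₜ[ℂ] tprod n (Fin.tail v) : H ⊗[ℂ] TensorPow H n)

theorem inner_tprod (n : ℕ) (v w : Fin n → H) :
    inner ℂ (tprod n v) (tprod n w) = ∏ i, inner ℂ (v i) (w i) := by
  induction n with
  | zero =>
    change inner ℂ (EuclideanSpace.single PUnit.unit (1 : ℂ) : EuclideanSpace ℂ PUnit.{u + 1})
      (EuclideanSpace.single PUnit.unit (1 : ℂ)) = _
    simp
  | succ n ih =>
    change inner ℂ (v 0 ⊗ₜ[ℂ] tprod n (Fin.tail v) : H ⊗[ℂ] TensorPow H n)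
      (w 0 ⊗ₜ[ℂ] tprod n (Fin.tail w)) = _
    rw [TensorProduct.inner_tmul, ih, Fin.prod_univ_succ]
    rfl

/-- The symmetrized product `u₁ ⊗ₛ ⋯ ⊗ₛ uₙ = (1 / n!) ∑ u_{σ 1} ⊗ ⋯ ⊗ u_{σ n}` in the Hilbert
tensor power, the completion of the algebraic one. -/
def symTprod (n : ℕ) (v : Fin n → H) : UniformSpace.Completion (TensorPow H n) :=
  ((n.factorial : ℂ)⁻¹) • ∑ σ : Equiv.Perm (Fin n), ((tprod n (v ∘ σ) : TensorPow H n) :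
    UniformSpace.Completion (TensorPow H n))

variable (H)

/-- The bosonic `n`-particle space `H^{⊗ₛ n}`: the closed subspace of the Hilbert tensor power
`H^{⊗ n}` spanned by the symmetrized products. -/
def bosonSector (n : ℕ) : Submodule ℂ (UniformSpace.Completion (TensorPow H n)) :=
  (Submodule.span ℂ (Set.range (symTprod (H := H) n))).topologicalClosure

instance (n : ℕ) : CompleteSpace (bosonSector H n) :=
  Submodule.topologicalClosure.completeSpace _

/-- The bosonic Fock space: the Hilbert direct sum of the `H^{⊗ₛ n}`, `n ∈ ℕ`. -/
abbrev Fock : Type u := lp (fun n : ℕ => bosonSector H n) 2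

variable {H}

/-- `u₁ ⊗ₛ ⋯ ⊗ₛ uₙ` as an element of the Fock space. -/
def fockProd (n : ℕ) (v : Fin n → H) : Fock H :=
  lp.single 2 n
    ⟨symTprod n v, Submodule.le_topologicalClosure _ (Submodule.subset_span ⟨v, rfl⟩)⟩

/-- The graph of the operator `⨁ₙ ∑ᵢ Aᵢ` on `⋃_N ⨁_{n ≤ N} D(A)^{⊗ₛ n}` (algebraic sums and
symmetric tensor powers): it is spanned by the pairs
`(u₁ ⊗ₛ ⋯ ⊗ₛ uₙ, ∑ᵢ u₁ ⊗ₛ ⋯ ⊗ₛ A uᵢ ⊗ₛ ⋯ ⊗ₛ uₙ)` with `uᵢ ∈ D(A)`. -/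
def dGammaGraph (A : H →ₗ.[ℂ] H) : Submodule ℂ (Fock H × Fock H) :=
  Submodule.span ℂ {p | ∃ (n : ℕ) (v : Fin n → A.domain),
    p = (fockProd n (fun j => (v j : H)),
      ∑ i, fockProd n (Function.update (fun j => (v j : H)) i (A (v i))))}

/-- The second quantization `dΓ(A)` of a positive self-adjoint operator `A`: the Friedrichs
extension of `⨁ₙ ∑ᵢ Aᵢ` on `⋃_N ⨁_{n ≤ N} D(A)^{⊗ₛ n}`. -/
def dGamma (A : H →ₗ.[ℂ] H) : Fock H →ₗ.[ℂ] Fock H :=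
  friedrichs (dGammaGraph A).toLinearPMap

end Fock

/-! ## The one-particle operators on `L²(X, μ)` -/

section OneParticle

variable {X : Type u} [MeasurableSpace X]

/-- The function `ω ^ s f`. -/
def wpow (ω : X → ℝ) (s : ℝ) (f : X → ℂ) : X → ℂ := fun x => ((ω x ^ s : ℝ) : ℂ) * f x

/-- The pairing `⟨g | h⟩ = ∫ conj g · h dμ`, linear in the second variable. -/
def pairing (μ : Measure X) (g h : X → ℂ) : ℂ := ∫ x, conj (g x) * h x ∂μ

/-- The regularized function `fₙ = 1_{ω ≤ n} f`. -/
def cutoff (ω : X → ℝ) (n : ℕ) (f : X → ℂ) : X → ℂ := {x | ω x ≤ n}.indicator f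

/-- The operator of multiplication by the real function `w` in `L²(X, μ)`, on its maximal
domain `{φ | w φ ∈ L²}`. -/
def mulOp (μ : Measure X) (w : X → ℝ) : Lp ℂ 2 μ →ₗ.[ℂ] Lp ℂ 2 μ where
  domain :=
    { carrier := {φ | MemLp (fun x => (w x : ℂ) * φ x) 2 μ}
      add_mem' := by
        intro φ ψ hφ hψ
        refine (MemLp.add hφ hψ).ae_eq ?_
        filter_upwards [Lp.coeFn_add φ ψ] with x hx
        rw [Pi.add_apply, hx, Pi.add_apply, mul_add]
      zero_mem' := by
        refine (MemLp.zero (μ := μ) (p := 2) (ε := ℂ)).ae_eq ?_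
        filter_upwards [Lp.coeFn_zero ℂ 2 μ] with x hx
        rw [hx, Pi.zero_apply, mul_zero]
      smul_mem' := by
        intro c φ hφ
        refine (MemLp.const_smul hφ c).ae_eq ?_
        filter_upwards [Lp.coeFn_smul c φ] with x hx
        rw [Pi.smul_apply, hx, Pi.smul_apply, smul_eq_mul, smul_eq_mul, mul_left_comm] }
  toFun :=
    { toFun := fun φ => MemLp.toLp _ φ.2
      map_add' := by
        intro φ ψ
        rw [← MemLp.toLp_add]
        refine MemLp.toLp_congr _ _ ?_
        filter_upwards [Lp.coeFn_add (φ : Lp ℂ 2 μ) ψ] with x hx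
        rw [Pi.add_apply, Submodule.coe_add, hx, Pi.add_apply, mul_add]
      map_smul' := by
        intro c φ
        rw [RingHom.id_apply, ← MemLp.toLp_const_smul]
        refine MemLp.toLp_congr _ _ ?_
        filter_upwards [Lp.coeFn_smul c (φ : Lp ℂ 2 μ)] with x hx
        rw [Pi.smul_apply, Submodule.coe_smul, hx, Pi.smul_apply, smul_eq_mul, smul_eq_mul,
          mul_left_comm] }

/-- The operator `ω² + 4 κ |ψ⟩⟨ψ|` with domain `D(ω²)`, for `ψ ∈ L²(X, μ)`. -/
def rankOnePerturbation (μ : Measure X) (ω : X → ℝ) (κ : ℝ) (ψ : Lp ℂ 2 μ) :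
    Lp ℂ 2 μ →ₗ.[ℂ] Lp ℂ 2 μ :=
  (((4 * κ : ℝ) : ℂ) • InnerProductSpace.rankOne ℂ ψ ψ : Lp ℂ 2 μ →L[ℂ] Lp ℂ 2 μ).toLinearMap +ᵥ
    mulOp μ (fun x => ω x ^ 2)

/-- `ξ = (ω² + 4 κ ω^{1/2} |g⟩⟨g| ω^{1/2})^{1/2}`, for `g` with `ω^{1/2} g ∈ L²`. -/
def IsXi (μ : Measure X) (ω : X → ℝ) (g : X → ℂ) (κ : ℝ)
    (ξ : Lp ℂ 2 μ →ₗ.[ℂ] Lp ℂ 2 μ) : Prop :=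
  ∃ hg : MemLp (wpow ω (1 / 2) g) 2 μ,
    IsPositiveSqrt ξ (rankOnePerturbation μ ω κ (hg.toLp _))

/-- The image of `φ` under the renormalized resolvent
`(ω² - z)⁻¹ - 4 κ (1 + 4 κ z ⟨f | ω⁻¹ (ω² - z)⁻¹ f⟩)⁻¹ ω^{1/2} (ω² - z)⁻¹ |f⟩⟨f| ω^{1/2} (ω² - z)⁻¹`,
as a function on `X`. -/
def renormalizedResolvent (μ : Measure X) (ω : X → ℝ) (f : X → ℂ) (κ : ℝ) (z : ℂ)
    (φ : X → ℂ) : X → ℂ := fun x =>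
  ((ω x : ℂ) ^ 2 - z)⁻¹ * φ x -
    4 * κ / (1 + 4 * κ * z * pairing μ f (wpow ω (-1) fun y => ((ω y : ℂ) ^ 2 - z)⁻¹ * f y)) *
      pairing μ f (wpow ω (1 / 2) fun y => ((ω y : ℂ) ^ 2 - z)⁻¹ * φ y) *
      wpow ω (1 / 2) (fun y => ((ω y : ℂ) ^ 2 - z)⁻¹ * f y) x

/-- `ξ` is the renormalized operator `ξ_κ`: the positive square root of the self-adjoint operator
whose resolvent on `ℂ \ ℝ` is the renormalized resolvent. -/
def IsRenormalizedXi (μ : Measure X) (ω : X → ℝ) (f : X → ℂ) (κ : ℝ)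
    (ξ : Lp ℂ 2 μ →ₗ.[ℂ] Lp ℂ 2 μ) : Prop :=
  ∃ A : Lp ℂ 2 μ →ₗ.[ℂ] Lp ℂ 2 μ, IsSelfAdjoint A ∧
    (∀ z : ℂ, z.im ≠ 0 → ∃ R : Lp ℂ 2 μ →L[ℂ] Lp ℂ 2 μ, IsResolventAt A z R ∧
      ∀ φ : Lp ℂ 2 μ, R φ =ᵐ[μ] renormalizedResolvent μ ω f κ z φ) ∧
    IsPositiveSqrt ξ A

end OneParticle

end QuadBose

end

noncomputable section

namespace QuadBose

/-! ### Resolvents of unbounded operators, described through graphs -/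

section Operators

variable {E : Type*} [NormedAddCommGroup E] [InnerProductSpace ℂ E]

/-! The singular perturbation becomes harmless once operators are replaced by their bounded
inverses. Put `g = ω^{-3/2} f ∈ L²` and `gₙ = 1_{ω ≤ n} g`. By Sherman–Morrison
(`IsResolventAt.vadd_rankOne`) the inverse of the cut-off operator is `ω⁻² - 4λ |gₙ⟩⟨gₙ|`: the
formula for `λₙ` is exactly what makes the coupling in the inverse equal to `λ` for every `n`. As `λ
< 0`, these inverses are positive and injective, and `gₙ → g` in `L²` makes them converge in norm to
`ω⁻² - 4λ |g⟩⟨g|`. The inverse of this limit is the renormalized operator; its resolvent is computed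
in `renormalizedResolvent_ae_eq`.

The positive square root of an operator with positive bounded inverse `B` is unique and has inverse
`B^{1/2}` (`existsUnique_isPositiveSqrt`). Continuity of the square root on positive operators then
gives norm convergence of the inverses of `ξₙ` to that of `ξ`.

Second quantization does not increase the distance between inverses (`norm_sub_le_of_dGammaGraph`):
`‖(dΓ(A') + 1)⁻¹ - (dΓ(A) + 1)⁻¹‖ ≤ ‖A'⁻¹ - A⁻¹‖`. Indeed, on `n`-particle vectors `⟨Φ, dΓ(A)Ψ⟩ -
⟨dΓ(A')Φ, Ψ⟩ = ∑ᵢ ⟨A'ᵢΦ, (A'⁻¹ - A⁻¹)ᵢ AᵢΨ⟩`. By Cauchy–Schwarz and `∑ᵢ ‖AᵢΨ‖² ≤ ‖dΓ(A)Ψ‖²`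
(commuting positive operators have nonnegative cross terms), the constant is independent of `n`.
Convergence at `-1` propagates to all nonreal points. To stay with bounded operators, `Ψ` is written
as `C^{⊗n} x` with `C = A⁻¹`, so that `AᵢΨ` is `C ⊗ ⋯ ⊗ 1 ⊗ ⋯ ⊗ C` applied to `x`. -/

theorem isResolventAt_iff {A : E →ₗ.[ℂ] E} {z : ℂ} {R : E →L[ℂ] E} :
    IsResolventAt A z R ↔ ∀ x y : E, (x, y) ∈ A.graph ↔ x = R (y - z • x) := by
  constructor
  · rintro ⟨h₁, h₂⟩ x y
    constructor
    · intro h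
      obtain ⟨a, rfl, rfl⟩ := (LinearPMap.mem_graph_iff A).1 h
      exact (h₂ a).symm
    · intro h
      obtain ⟨hd, hy⟩ := h₁ (y - z • x)
      rw [LinearPMap.mem_graph_iff]
      refine ⟨⟨_, hd⟩, h.symm, ?_⟩
      rw [sub_eq_iff_eq_add.1 hy, ← h]
      simp
  · intro h
    constructor
    · intro y
      have hy : (R y, y + z • R y) ∈ A.graph := (h _ _).2 (by simp)
      obtain ⟨a, ha, ha'⟩ := (LinearPMap.mem_graph_iff A).1 hy
      have hd : R y ∈ A.domain := by
        have := a.2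
        rwa [ha] at this
      refine ⟨hd, ?_⟩
      have : a = ⟨R y, hd⟩ := Subtype.ext ha
      rw [← this, ha']
      simp
    · intro x
      exact ((h _ _).1 (A.mem_graph x)).symm

theorem IsResolventAt.injective {A : E →ₗ.[ℂ] E} {z : ℂ} {R : E →L[ℂ] E}
    (h : IsResolventAt A z R) (y : E) (hy : R y = 0) : y = 0 := by
  rw [isResolventAt_iff] at h
  have : ((0 : E), y) ∈ A.graph := (h _ _).2 (by simp [hy])
  exact A.graph_fst_eq_zero_snd this rfl

theorem IsResolventAt.eq {A B : E →ₗ.[ℂ] E} {z : ℂ} {R : E →L[ℂ] E}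
    (hA : IsResolventAt A z R) (hB : IsResolventAt B z R) : A = B := by
  rw [isResolventAt_iff] at hA hB
  refine LinearPMap.eq_of_eq_graph ?_
  ext ⟨x, y⟩
  rw [hA, hB]

/-- The operator is `R⁻¹ + z`; injectivity of `R` is what makes its graph single-valued. -/
theorem exists_isResolventAt (z : ℂ) (R : E →L[ℂ] E) (hR : ∀ y, R y = 0 → y = 0) :
    ∃ A : E →ₗ.[ℂ] E, IsResolventAt A z R := by
  let G : Submodule ℂ (E × E) :=
    { carrier := {p | p.1 = R (p.2 - z • p.1)}
      add_mem' := by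
        intro p q hp hq
        simp only [Set.mem_ofPred_eq, Prod.fst_add, Prod.snd_add] at hp hq ⊢
        conv_lhs => rw [hp, hq]
        rw [← map_add]
        congr 1
        module
      zero_mem' := by simp
      smul_mem' := by
        intro c p hp
        simp only [Set.mem_ofPred_eq, Prod.smul_fst, Prod.smul_snd] at hp ⊢
        conv_lhs => rw [hp]
        rw [← map_smul]
        congr 1
        module }
  refine ⟨G.toLinearPMap, ?_⟩
  rw [isResolventAt_iff]
  intro x y
  rw [Submodule.toLinearPMap_graph_eq]
  · rfl
  · rintro ⟨a, b⟩ hab rfl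
    exact hR b (by simpa [G, eq_comm] using! hab)

variable [CompleteSpace E]

theorem _root_.LinearPMap.mem_graph_adjoint_iff {A : E →ₗ.[ℂ] E} (hA : Dense (A.domain : Set E))
    (x y : E) : (x, y) ∈ A.adjoint.graph ↔
      ∀ a b, (a, b) ∈ A.graph → (inner ℂ b x : ℂ) = inner ℂ a y := by
  rw [LinearPMap.adjoint_graph_eq_graph_adjoint hA, Submodule.mem_adjoint_iff]
  simp only [sub_eq_zero]

theorem _root_.Submodule.dense_of_inner {K : Submodule ℂ E}
    (h : ∀ x, (∀ a ∈ K, (inner ℂ a x : ℂ) = 0) → x = 0) : Dense (K : Set E) := by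
  rw [Submodule.dense_iff_topologicalClosure_eq_top,
    Submodule.topologicalClosure_eq_top_iff, Submodule.eq_bot_iff]
  exact fun x hx => h x fun a ha => (Submodule.mem_orthogonal _ _).1 hx a ha

theorem _root_.IsSelfAdjoint.inner_symm {M : E →L[ℂ] E} (hM : IsSelfAdjoint M) (x y : E) :
    (inner ℂ (M x) y : ℂ) = inner ℂ x (M y) :=
  hM.isSymmetric x y

/-- A vector `x` orthogonal to the range of `M` is orthogonal to `M (M x)`, so `M x = 0` and `x =
0`: the domain is dense. Symmetry of `M` then turns the adjoint condition back into the graph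
equation `x = M (y - c x)`. -/
theorem IsResolventAt.isSelfAdjoint {A : E →ₗ.[ℂ] E} {c : ℝ} {M : E →L[ℂ] E}
    (h : IsResolventAt A c M) (hM : IsSelfAdjoint M) : IsSelfAdjoint A := by
  have hi := h.injective
  rw [isResolventAt_iff] at h
  have hg : ∀ u, (M u, u + (c : ℂ) • M u) ∈ A.graph := fun u => (h _ _).2 (by simp)
  have hd : Dense (A.domain : Set E) := by
    refine Submodule.dense_of_inner fun x hx => hi x ?_
    have h1 := hx (M (M x)) (LinearPMap.mem_domain_of_mem_graph (hg _))
    rw [hM.inner_symm, inner_self_eq_zero] at h1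
    exact h1
  rw [LinearPMap.isSelfAdjoint_def]
  refine LinearPMap.eq_of_eq_graph ?_
  ext ⟨x, y⟩
  rw [LinearPMap.mem_graph_adjoint_iff hd, h]
  constructor
  · intro hxy
    rw [← sub_eq_zero, ← inner_self_eq_zero (𝕜 := ℂ)]
    have h1 : ∀ u, (inner ℂ u (x - M (y - (c : ℂ) • x)) : ℂ) = 0 := by
      intro u
      have := hxy _ _ (hg u)
      simp only [inner_add_left, inner_smul_left, Complex.conj_ofReal] at this
      rw [inner_sub_right, ← hM.inner_symm, inner_sub_right, inner_smul_right, ← this]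
      ring
    exact h1 _
  · intro hx a b hab
    rw [h] at hab
    have e1 : (inner ℂ b x : ℂ) = inner ℂ (b - (c : ℂ) • a) x + c * inner ℂ a x := by
      rw [inner_sub_left, inner_smul_left, Complex.conj_ofReal, sub_add_cancel]
    have e2 : (inner ℂ a y : ℂ) = inner ℂ a (y - (c : ℂ) • x) + c * inner ℂ a x := by
      rw [inner_sub_right, inner_smul_right, sub_add_cancel]
    rw [e1, e2]
    congr 1
    rw [hx, ← hM.inner_symm, ← hab, ← hx]

theorem isUnit_one_sub_smul {M : E →L[ℂ] E} (hM : IsSelfAdjoint M) {z : ℂ} (hz : z.im ≠ 0) :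
    IsUnit (1 - z • M) := by
  have hz0 : z ≠ 0 := by
    rintro rfl
    simp at hz
  have h1 : z⁻¹ ∉ spectrum ℂ M := fun h => by
    have h2 := hM.mem_spectrum_eq_re h
    have h3 : (z⁻¹).im = 0 := by rw [h2, Complex.ofReal_im]
    rw [Complex.inv_im, div_eq_zero_iff] at h3
    rcases h3 with h3 | h3
    · exact hz (neg_eq_zero.1 h3)
    · exact hz0 (Complex.normSq_eq_zero.1 h3)
  rw [spectrum.notMem_iff] at h1
  have h2 : (1 - z • M : E →L[ℂ] E) = (algebraMap ℂ (E →L[ℂ] E) z) *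
      (algebraMap ℂ (E →L[ℂ] E) z⁻¹ - M) := by
    rw [mul_sub, ← map_mul, mul_inv_cancel₀ hz0, map_one, Algebra.algebraMap_eq_smul_one,
      smul_mul_assoc, one_mul]
  rw [h2]
  exact ((Ne.isUnit hz0).map _).mul h1

/-- The graph equation reads `x = M (y - c x) = M (y - z x) + (z - c) M x`; solve it for `x`, which
is possible because the spectrum of `M` is real. -/
theorem IsResolventAt.of_im_ne_zero {A : E →ₗ.[ℂ] E} {c : ℝ} {M : E →L[ℂ] E}
    (h : IsResolventAt A c M) (hM : IsSelfAdjoint M) {z : ℂ} (hz : z.im ≠ 0) :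
    IsResolventAt A z (Ring.inverse (1 - (z - c) • M) * M) := by
  have hu : IsUnit (1 - (z - c) • M) := isUnit_one_sub_smul hM (by simpa using hz)
  rw [isResolventAt_iff] at h ⊢
  intro x y
  rw [h]
  have e : M (y - (c : ℂ) • x) = M (y - z • x) + ((z - c) • M) x := by
    rw [smul_apply, ← map_smul, ← map_add]
    congr 1
    module
  rw [e, ← sub_eq_iff_eq_add]
  constructor
  · intro hx
    have : (1 - (z - c) • M) x = M (y - z • x) := hx
    rw [mul_apply_eq_comp, ← this, ← mul_apply_eq_comp,
      Ring.inverse_mul_cancel _ hu, one_apply_eq_self]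
  · intro hx
    change (1 - (z - c) • M) x = _
    conv_lhs => rw [hx, ← mul_apply_eq_comp, ← mul_assoc, Ring.mul_inverse_cancel _ hu,
      one_mul]

/-- One real point suffices, since the resolvent at `z` is `(1 - (z - c) M)⁻¹ M` and inversion is
continuous at units. -/
theorem normResolventTendsto_of_tendsto {A : ℕ → E →ₗ.[ℂ] E} {B : E →ₗ.[ℂ] E} {c : ℝ}
    {M : ℕ → E →L[ℂ] E} {N : E →L[ℂ] E} (hA : ∀ n, IsResolventAt (A n) c (M n))
    (hB : IsResolventAt B c N) (hM : ∀ n, IsSelfAdjoint (M n)) (hN : IsSelfAdjoint N)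
    (h : Tendsto M atTop (𝓝 N)) : NormResolventTendsto A B where
  selfAdjoint_seq n := (hA n).isSelfAdjoint (hM n)
  selfAdjoint_lim := hB.isSelfAdjoint hN
  tendsto_resolvent z hz := by
    refine ⟨_, _, fun n => (hA n).of_im_ne_zero (hM n) hz, hB.of_im_ne_zero hN hz, ?_⟩
    rw [← tendsto_iff_norm_sub_tendsto_zero]
    obtain ⟨u, hu⟩ : IsUnit (1 - (z - c) • N) := isUnit_one_sub_smul hN (by simpa using hz)
    have h1 : Tendsto (fun n => 1 - (z - c) • M n) atTop (𝓝 (u : E →L[ℂ] E)) := by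
      rw [hu]
      exact tendsto_const_nhds.sub (h.const_smul _)
    rw [← hu]
    exact ((NormedRing.inverse_continuousAt u).tendsto.comp h1).mul h

/-! ### Positive square roots and Friedrichs extensions -/

theorem IsResolventAt.isPositiveSqrt {A T : E →ₗ.[ℂ] E} {B : E →L[ℂ] E}
    (hA : IsResolventAt A 0 B) (hB : 0 ≤ B) (hT : IsResolventAt T 0 (CFC.sqrt B)) :
    IsPositiveSqrt T A := by
  have hC : 0 ≤ CFC.sqrt B := CFC.sqrt_nonneg B
  have hC' := (ContinuousLinearMap.nonneg_iff_isPositive _).1 hC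
  have hCC : CFC.sqrt B * CFC.sqrt B = B := CFC.sqrt_mul_sqrt_self B hB
  refine ⟨IsResolventAt.isSelfAdjoint (c := 0) (by simpa using hT) hC'.isSelfAdjoint, ?_, ?_⟩
  · intro x
    have h1 := (hT.2 x)
    rw [zero_smul, sub_zero] at h1
    conv_rhs => rw [← h1]
    exact hC'.inner_nonneg_left (T x) |>.1
  · intro x z
    rw [isResolventAt_iff] at hA hT
    simp only [hA, hT, zero_smul, sub_zero]
    nth_rewrite 1 [← hCC]
    constructor
    · intro h
      exact ⟨_, h, rfl⟩
    · rintro ⟨y, h1, h2⟩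
      rw [h1, h2]
      rfl

/-- This is the uniqueness of the square root. Since `A = T ∘ T` is invertible, so is `T`; its
inverse `D` is bounded, positive and satisfies `D² = B`, so uniqueness of positive square roots of
bounded operators applies. -/
theorem IsPositiveSqrt.isResolventAt {A T : E →ₗ.[ℂ] E} {B : E →L[ℂ] E}
    (hT : IsPositiveSqrt T A) (hA : IsResolventAt A 0 B) : IsResolventAt T 0 (CFC.sqrt B) := by
  obtain ⟨hsa, hpos, hsq⟩ := hT
  have hd := hsa.dense_domain
  have hB0 := hA.injective
  rw [isResolventAt_iff] at hA
  simp only [zero_smul, sub_zero] at hA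
  have hsym : ∀ a b c d, (a, b) ∈ T.graph → (c, d) ∈ T.graph →
      (inner ℂ b c : ℂ) = inner ℂ a d := by
    intro a b c d hab hcd
    rw [← LinearPMap.isSelfAdjoint_def.1 hsa, LinearPMap.mem_graph_adjoint_iff hd] at hcd
    exact hcd a b hab
  have hpos' : ∀ a b, (a, b) ∈ T.graph → 0 ≤ (inner ℂ a b : ℂ).re := by
    intro a b hab
    obtain ⟨x, rfl, rfl⟩ := (LinearPMap.mem_graph_iff T).1 hab
    exact hpos x
  have hex : ∀ z, ∃ y, (B z, y) ∈ T.graph ∧ (y, z) ∈ T.graph := fun z => (hsq _ _).1 ((hA _ _).2 rfl)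
  choose D₀ hD₁ hD₂ using hex
  have hker : ∀ y, (y, 0) ∈ T.graph → y = 0 := by
    intro y hy
    have h1 : ((y, (0 : E)) : E × E) ∈ A.graph := (hsq _ _).2 ⟨0, hy, T.graph.zero_mem⟩
    rw [hA, map_zero] at h1
    exact h1
  have hinj : ∀ y y' z, (y, z) ∈ T.graph → (y', z) ∈ T.graph → y = y' := by
    intro y y' z h1 h2
    rw [← sub_eq_zero]
    refine hker _ ?_
    have := T.graph.sub_mem h1 h2
    simpa using this
  let Dl : E →ₗ[ℂ] E :=
    { toFun := D₀
      map_add' := fun x y => hinj _ _ _ (hD₂ _) (T.graph.add_mem (hD₂ x) (hD₂ y))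
      map_smul' := fun c x => hinj _ _ _ (hD₂ _) (T.graph.smul_mem c (hD₂ x)) }
  -- Boundedness comes from `‖D z‖² = ⟨T B z, D z⟩ = ⟨B z, T D z⟩ = ⟨B z, z⟩`.
  have hbd : ∀ z, ‖D₀ z‖ ≤ Real.sqrt ‖B‖ * ‖z‖ := by
    intro z
    have h1 := hsym _ _ _ _ (hD₁ z) (hD₂ z)
    have h2 : ‖D₀ z‖ ^ 2 ≤ ‖B‖ * ‖z‖ ^ 2 := by
      rw [← inner_self_eq_norm_sq (𝕜 := ℂ), h1]
      calc _ ≤ ‖(inner ℂ (B z) z : ℂ)‖ := RCLike.re_le_norm _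
        _ ≤ ‖B z‖ * ‖z‖ := norm_inner_le_norm _ _
        _ ≤ ‖B‖ * ‖z‖ * ‖z‖ := by gcongr; exact B.le_opNorm z
        _ = _ := by ring
    refine (sq_le_sq₀ (norm_nonneg _) (by positivity)).1 ?_
    rw [mul_pow, Real.sq_sqrt (norm_nonneg _)]
    exact h2
  let D : E →L[ℂ] E := Dl.mkContinuous _ hbd
  have hDD : D * D = B := by
    ext z
    exact hinj _ _ _ (hD₂ _) (hD₁ z)
  have hDpos : 0 ≤ D := by
    rw [ContinuousLinearMap.nonneg_iff_isPositive, ContinuousLinearMap.isPositive_def']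
    refine ⟨?_, fun x => ?_⟩
    · rw [ContinuousLinearMap.isSelfAdjoint_iff_isSymmetric]
      intro x y
      exact (hsym _ _ _ _ (hD₂ x) (hD₂ y)).symm
    · exact hpos' _ _ (hD₂ x)
  rw [CFC.sqrt_unique hDD hDpos, isResolventAt_iff]
  intro x y
  rw [zero_smul, sub_zero]
  exact ⟨fun h => hinj _ _ _ h (hD₂ y), fun h => h ▸ hD₂ y⟩

/-- A self-adjoint operator with positive bounded inverse `B` has a unique positive square root;
its bounded inverse is the square root of `B`. -/
theorem existsUnique_isPositiveSqrt {A : E →ₗ.[ℂ] E} {B : E →L[ℂ] E}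
    (hA : IsResolventAt A 0 B) (hB : 0 ≤ B) : ∃! T, IsPositiveSqrt T A := by
  obtain ⟨T, hT⟩ := exists_isResolventAt 0 (CFC.sqrt B) fun y hy => hA.injective y <| by
    rw [← CFC.sqrt_mul_sqrt_self B hB, mul_apply_eq_comp, hy, map_zero]
  exact ⟨T, hA.isPositiveSqrt hB hT, fun T' hT' => (hT'.isResolventAt hA).eq hT⟩

theorem tendsto_cfcSqrt {B : ℕ → E →L[ℂ] E} {C : E →L[ℂ] E} (hB : ∀ n, 0 ≤ B n) (hC : 0 ≤ C)
    (h : Tendsto B atTop (𝓝 C)) : Tendsto (fun n => CFC.sqrt (B n)) atTop (𝓝 (CFC.sqrt C)) := by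
  have hc : ContinuousOn (CFC.sqrt (A := E →L[ℂ] E)) {a | 0 ≤ a} := CFC.continuousOn_sqrt
  exact (hc C hC).tendsto.comp (tendsto_nhdsWithin_iff.2 ⟨h, Eventually.of_forall hB⟩)

/-- An essentially self-adjoint positive operator: the Friedrichs extension has the bounded
inverse `M` at `-1`. -/
theorem exists_isResolventAt_friedrichs {G : Submodule ℂ (E × E)}
    (hsym : ∀ p ∈ G, ∀ q ∈ G, (inner ℂ p.1 q.2 : ℂ) = inner ℂ p.2 q.1)
    (hpos : ∀ p ∈ G, 0 ≤ (inner ℂ p.1 p.2 : ℂ).re)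
    (hdense : ∀ x, (∀ p ∈ G, (inner ℂ p.1 x : ℂ) = 0) → x = 0)
    (hrange : ∀ x, (∀ p ∈ G, (inner ℂ (p.1 + p.2) x : ℂ) = 0) → x = 0) :
    ∃ M : E →L[ℂ] E, IsSelfAdjoint M ∧
      IsResolventAt (friedrichs G.toLinearPMap) ((-1 : ℝ) : ℂ) M ∧
      ∀ p ∈ G, M (p.1 + p.2) = p.1 := by
  have hgraph : G.toLinearPMap.graph = G := Submodule.toLinearPMap_graph_eq _ fun p hp h0 =>
    hdense _ fun q hq => by rw [hsym q hq p hp, h0, inner_zero_right]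
  set S := G.toLinearPMap
  have hSd : Dense (S.domain : Set E) := Submodule.dense_of_inner fun x hx =>
    hdense x fun p hp => hx _ (Submodule.mem_map_of_mem (f := LinearMap.fst ℂ E E) hp)
  let f : G →ₗ[ℂ] E := (LinearMap.fst ℂ E E).comp G.subtype
  let e : G →ₗ[ℂ] E := (LinearMap.fst ℂ E E + LinearMap.snd ℂ E E).comp G.subtype
  have he : DenseRange e := by
    have : Dense ((LinearMap.range e : Submodule ℂ E) : Set E) :=
      Submodule.dense_of_inner fun x hx => hrange x fun p hp => hx _ ⟨⟨p, hp⟩, rfl⟩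
    rwa [LinearMap.coe_range] at this
  -- Positivity gives `‖u‖ ≤ ‖(S + 1) u‖`, so `(S + 1)⁻¹` extends from the dense range of `S + 1` to
  -- a bounded `M`.
  have hnorm : ∀ p, ‖f p‖ ≤ 1 * ‖e p‖ := by
    rintro ⟨p, hp⟩
    rw [one_mul]
    refine (sq_le_sq₀ (norm_nonneg _) (norm_nonneg _)).1 ?_
    change ‖p.1‖ ^ 2 ≤ ‖p.1 + p.2‖ ^ 2
    rw [norm_add_sq (𝕜 := ℂ)]
    have := hpos p hp
    have h2 : RCLike.re (inner ℂ p.1 p.2 : ℂ) = (inner ℂ p.1 p.2 : ℂ).re := rfl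
    nlinarith [sq_nonneg ‖p.2‖]
  let M := f.extendOfNorm e
  have hMe : ∀ p, M (e p) = f p := LinearMap.extendOfNorm_eq he ⟨1, hnorm⟩
  have hMG : ∀ p ∈ G, M (p.1 + p.2) = p.1 := fun p hp => hMe ⟨p, hp⟩
  have hM : IsSelfAdjoint M := by
    rw [ContinuousLinearMap.isSelfAdjoint_iff_isSymmetric]
    intro x y
    change (inner ℂ (M x) y : ℂ) = inner ℂ x (M y)
    refine he.induction_on₂ (p := fun x y => (inner ℂ (M x) y : ℂ) = inner ℂ x (M y))
      (isClosed_eq (by fun_prop) (by fun_prop)) ?_ x y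
    rintro ⟨p, hp⟩ ⟨q, hq⟩
    rw [hMe, hMe]
    change (inner ℂ p.1 (q.1 + q.2) : ℂ) = inner ℂ (p.1 + p.2) q.1
    rw [inner_add_left, inner_add_right, hsym p hp q hq]
  have hadj : ∀ x y, (x, y) ∈ S.adjoint.graph ↔ x = M (x + y) := by
    intro x y
    rw [LinearPMap.mem_graph_adjoint_iff hSd, hgraph]
    constructor
    · intro h
      rw [← sub_eq_zero]
      refine hrange _ fun p hp => ?_
      rw [inner_sub_right, ← hM.inner_symm, hMG p hp, inner_add_left, inner_add_right,
        h p.1 p.2 hp]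
      ring
    · intro h a b hab
      have h1 : (inner ℂ (a + b) x : ℂ) = inner ℂ a (x + y) := by
        rw [h, ← hM.inner_symm, hMG _ hab, ← h]
      rw [inner_add_left, inner_add_right] at h1
      exact add_left_cancel h1
  -- The adjoint is the closure of `S`: approximating `x + y` in the range of `S + 1` gives
  -- convergence in the graph norm, hence in the form norm. So the Friedrichs restriction removes
  -- nothing from `S†`.
  have hform : S.adjoint.domain ≤ formDomain S := by
    intro x hx
    obtain ⟨y, hy⟩ := LinearPMap.mem_domain_iff.1 hx
    rw [hadj] at hy
    obtain ⟨u, hu, hlim⟩ := mem_closure_iff_seq_limit.1 (he (x + y))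
    choose p hp using hu
    have hl1 : Tendsto (fun k => (p k : E × E).1) atTop (𝓝 x) := by
      rw [hy]
      refine ((M.continuous.tendsto _).comp hlim).congr fun k => ?_
      rw [Function.comp_apply, ← hp k, hMe]
      rfl
    have hl2 : Tendsto (fun k => (p k : E × E).2) atTop (𝓝 y) := by
      have := hlim.sub hl1
      rw [add_sub_cancel_left] at this
      refine this.congr fun k => ?_
      rw [← hp k]
      exact add_sub_cancel_left _ _
    have hmem : ∀ k, ((p k : E × E).1, (p k : E × E).2) ∈ S.graph := fun k => by
      rw [hgraph]
      exact (p k).2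
    choose v hv hv' using fun k => (LinearPMap.mem_graph_iff S).1 (hmem k)
    refine Submodule.subset_span ⟨v, by simpa only [hv] using hl1, fun ε hε => ?_⟩
    have hc1 := hl1.cauchySeq
    have hc2 := hl2.cauchySeq
    rw [Metric.cauchySeq_iff] at hc1 hc2
    obtain ⟨N₁, hN₁⟩ := hc1 1 one_pos
    obtain ⟨N₂, hN₂⟩ := hc2 ε hε
    refine ⟨max N₁ N₂, fun k hk l hl => ?_⟩
    have h1 := hN₁ k (le_of_max_le_left hk) l (le_of_max_le_left hl)
    have h2 := hN₂ k (le_of_max_le_right hk) l (le_of_max_le_right hl)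
    rw [dist_eq_norm] at h1 h2
    rw [LinearPMap.map_sub, Submodule.coe_sub, hv, hv, hv', hv']
    calc _ ≤ ‖(p k : E × E).1 - (p l : E × E).1‖ * ‖(p k : E × E).2 - (p l : E × E).2‖ :=
          norm_inner_le_norm _ _
      _ ≤ 1 * ‖(p k : E × E).2 - (p l : E × E).2‖ := by gcongr
      _ < ε := by rwa [one_mul]
  refine ⟨M, hM, ?_, hMG⟩
  have hF : friedrichs S = S.adjoint := by
    refine LinearPMap.eq_of_le_of_domain_eq LinearPMap.domRestrict_le ?_
    rw [friedrichs, LinearPMap.domRestrict_domain]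
    exact inf_eq_right.2 hform
  rw [hF, isResolventAt_iff]
  intro x y
  rw [hadj]
  simp [add_comm]

end Operators

/-! ### Norms of tensor products of bounded operators -/

section TensorNorm

variable {E F : Type*} [NormedAddCommGroup E] [InnerProductSpace ℂ E]
  [NormedAddCommGroup F] [InnerProductSpace ℂ F]

/-- The left legs of a finite tensor span a finite-dimensional space; expand them in an orthonormal
basis of it. Pythagoras then computes the norm, so `1 ⊗ D` can be bounded term by term. -/
theorem exists_orthonormal_eq_sum_tmul (x : E ⊗[ℂ] F) :
    ∃ (n : ℕ) (e : Fin n → E) (y : Fin n → F), Orthonormal ℂ e ∧ x = ∑ i, e i ⊗ₜ[ℂ] y i := by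
  classical
  obtain ⟨s, rfl⟩ := TensorProduct.exists_finset x
  let K : Submodule ℂ E := Submodule.span ℂ (s.image Prod.fst : Finset E)
  have : FiniteDimensional ℂ K := FiniteDimensional.span_finset ℂ _
  let b := stdOrthonormalBasis ℂ K
  refine ⟨_, fun i => (b i : E), fun i => ∑ p ∈ s, (inner ℂ (b i : E) p.1 : ℂ) • p.2,
    b.orthonormal.comp_linearIsometry K.subtypeₗᵢ, ?_⟩
  simp only [TensorProduct.tmul_sum, TensorProduct.tmul_smul]
  rw [Finset.sum_comm]
  refine Finset.sum_congr rfl fun p hp => ?_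
  have hpK : p.1 ∈ K := Submodule.subset_span (by simpa using ⟨p.2, hp⟩)
  have h := congrArg (Subtype.val) (b.sum_repr' ⟨p.1, hpK⟩)
  rw [Submodule.coe_sum] at h
  simp only [Submodule.coe_smul, Submodule.coe_inner] at h
  conv_lhs => rw [← h]
  rw [TensorProduct.sum_tmul]
  simp only [TensorProduct.smul_tmul']

theorem norm_sq_sum_tmul {n : ℕ} {e : Fin n → E} (he : Orthonormal ℂ e) (y : Fin n → F) :
    ‖∑ i, e i ⊗ₜ[ℂ] y i‖ ^ 2 = ∑ i, ‖y i‖ ^ 2 := by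
  rw [← inner_self_eq_norm_sq (𝕜 := ℂ), sum_inner, map_sum]
  refine Finset.sum_congr rfl fun i _ => ?_
  rw [inner_sum]
  simp only [TensorProduct.inner_tmul, orthonormal_iff_ite.1 he, ite_mul, one_mul, zero_mul,
    Finset.sum_ite_eq, Finset.mem_univ, if_true]
  exact inner_self_eq_norm_sq _

theorem norm_map_id_le (D : F →L[ℂ] F) (x : E ⊗[ℂ] F) :
    ‖TensorProduct.map LinearMap.id (D : F →ₗ[ℂ] F) x‖ ≤ ‖D‖ * ‖x‖ := by
  obtain ⟨n, e, y, he, rfl⟩ := exists_orthonormal_eq_sum_tmul x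
  rw [← sq_le_sq₀ (norm_nonneg _) (by positivity), mul_pow, norm_sq_sum_tmul he, map_sum]
  simp only [TensorProduct.map_tmul, LinearMap.id_apply, ContinuousLinearMap.coe_coe]
  rw [norm_sq_sum_tmul he, Finset.mul_sum]
  gcongr with i
  rw [← mul_pow]
  gcongr
  exact D.le_opNorm _

/-- Factor `B ⊗ D = (B ⊗ 1)(1 ⊗ D)`; the isometric flip reduces `B ⊗ 1` to the other case. -/
theorem norm_tensorMap_le (B : E →L[ℂ] E) (D : F →L[ℂ] F) (x : E ⊗[ℂ] F) :
    ‖TensorProduct.map (B : E →ₗ[ℂ] E) (D : F →ₗ[ℂ] F) x‖ ≤ ‖B‖ * ‖D‖ * ‖x‖ := by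
  have h1 : TensorProduct.map (B : E →ₗ[ℂ] E) (D : F →ₗ[ℂ] F) x =
      TensorProduct.comm ℂ F E (TensorProduct.map LinearMap.id (B : E →ₗ[ℂ] E)
        (TensorProduct.comm ℂ E F (TensorProduct.map LinearMap.id (D : F →ₗ[ℂ] F) x))) := by
    induction x with
    | zero => simp
    | tmul a b => simp
    | add a b ha hb => simp only [map_add, ha, hb]
  have h2 : ∀ y : F ⊗[ℂ] E, ‖TensorProduct.comm ℂ F E y‖ = ‖y‖ :=
    (TensorProduct.commIsometry ℂ F E).norm_map
  have h3 : ∀ y : E ⊗[ℂ] F, ‖TensorProduct.comm ℂ E F y‖ = ‖y‖ :=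
    (TensorProduct.commIsometry ℂ E F).norm_map
  rw [h1, h2]
  refine (norm_map_id_le B _).trans ?_
  rw [h3, mul_assoc]
  gcongr
  exact norm_map_id_le D x

/-- The tensor product of two bounded operators. -/
def tensorMap (B : E →L[ℂ] E) (D : F →L[ℂ] F) : E ⊗[ℂ] F →L[ℂ] E ⊗[ℂ] F :=
  (TensorProduct.map (B : E →ₗ[ℂ] E) (D : F →ₗ[ℂ] F)).mkContinuous _ (norm_tensorMap_le B D)

end TensorNorm

/-! ### Product operators on Hilbert tensor powers -/

section TensorPow

universe u

variable {H : Type u} [NormedAddCommGroup H] [InnerProductSpace ℂ H]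

theorem continuous_tprod (n : ℕ) : Continuous (tprod (H := H) n) := by
  induction n with
  | zero => exact continuous_const
  | succ n ih =>
    have h1 : Continuous fun v : Fin (n + 1) → H => (v 0, tprod n (Fin.tail v)) :=
      (continuous_apply 0).prodMk (ih.comp (continuous_pi fun i => continuous_apply i.succ))
    exact (TensorProduct.continuous_tmul (𝕜 := ℂ) (E := H) (F := TensorPow H n)).comp h1

theorem tprod_update_sub (n : ℕ) (v : Fin n → H) (i : Fin n) (a b : H) :
    tprod n (Function.update v i (a - b)) =
      tprod n (Function.update v i a) - tprod n (Function.update v i b) := by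
  induction n with
  | zero => exact i.elim0
  | succ n ih =>
    change (Function.update v i (a - b) 0 ⊗ₜ[ℂ] tprod n (Fin.tail (Function.update v i (a - b))) :
      H ⊗[ℂ] TensorPow H n) =
      Function.update v i a 0 ⊗ₜ[ℂ] tprod n (Fin.tail (Function.update v i a)) -
      Function.update v i b 0 ⊗ₜ[ℂ] tprod n (Fin.tail (Function.update v i b))
    induction i using Fin.cases with
    | zero =>
      simp only [Fin.tail_update_zero, Function.update_self]
      rw [TensorProduct.sub_tmul]
    | succ i =>
      simp only [Fin.tail_update_succ]
      rw [ih, TensorProduct.tmul_sub]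
      simp [Function.update_of_ne (Fin.succ_ne_zero i).symm]

theorem span_range_tprod (n : ℕ) : Submodule.span ℂ (Set.range (tprod (H := H) n)) = ⊤ := by
  induction n with
  | zero =>
    rw [eq_top_iff]
    rintro (x : EuclideanSpace ℂ PUnit.{u + 1}) -
    have : x = (x PUnit.unit) • (EuclideanSpace.single PUnit.unit (1 : ℂ)) := by
      ext j
      simp
    rw [this]
    exact Submodule.smul_mem _ _ (Submodule.subset_span ⟨Fin.elim0, rfl⟩)
  | succ n ih =>
    rw [eq_top_iff]
    rintro (x : H ⊗[ℂ] TensorPow H n) -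
    induction x with
    | zero => exact Submodule.zero_mem _
    | add x y hx hy => exact Submodule.add_mem _ hx hy
    | tmul a b =>
      have hb : b ∈ Submodule.span ℂ (Set.range (tprod (H := H) n)) := ih ▸ Submodule.mem_top
      induction hb using Submodule.span_induction with
      | mem b hb =>
        obtain ⟨v, rfl⟩ := hb
        refine Submodule.subset_span ⟨Fin.cons a v, ?_⟩
        rfl
      | zero =>
        rw [TensorProduct.tmul_zero]
        exact Submodule.zero_mem _
      | add b c _ _ hb hc =>
        rw [TensorProduct.tmul_add]
        exact Submodule.add_mem _ hb hc
      | smul r b _ hb =>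
        rw [TensorProduct.tmul_smul]
        exact Submodule.smul_mem _ _ hb

/-- The tensor product of `n` bounded operators on the algebraic tensor power. -/
def tensorPowMap : (n : ℕ) → (Fin n → H →L[ℂ] H) → (TensorPow H n →L[ℂ] TensorPow H n)
  | 0, _ => ContinuousLinearMap.id ℂ _
  | n + 1, B => (tensorMap (B 0) (tensorPowMap n (Fin.tail B)) :
      H ⊗[ℂ] TensorPow H n →L[ℂ] H ⊗[ℂ] TensorPow H n)

theorem tensorPowMap_tprod (n : ℕ) (B : Fin n → H →L[ℂ] H) (v : Fin n → H) :
    tensorPowMap n B (tprod n v) = tprod n fun i => B i (v i) := by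
  induction n with
  | zero => rfl
  | succ n ih =>
    change (B 0 (v 0) ⊗ₜ[ℂ] tensorPowMap n (Fin.tail B) (tprod n (Fin.tail v)) :
      H ⊗[ℂ] TensorPow H n) = _
    rw [ih]
    rfl

theorem norm_tensorPowMap_le (n : ℕ) (B : Fin n → H →L[ℂ] H) :
    ‖tensorPowMap n B‖ ≤ ∏ i, ‖B i‖ := by
  induction n with
  | zero => exact ContinuousLinearMap.norm_id_le
  | succ n ih =>
    rw [Fin.prod_univ_succ]
    have h : ‖(tensorMap (B 0) (tensorPowMap n (Fin.tail B)) :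
        H ⊗[ℂ] TensorPow H n →L[ℂ] H ⊗[ℂ] TensorPow H n)‖ ≤
          ‖B 0‖ * ‖tensorPowMap n (Fin.tail B)‖ :=
      LinearMap.mkContinuous_norm_le _ (by positivity) _
    refine h.trans ?_
    gcongr
    exact ih _

/-- The Hilbert tensor power `H^{⊗ n}`. -/
abbrev HTensorPow (H : Type u) [NormedAddCommGroup H] [InnerProductSpace ℂ H] (n : ℕ) : Type u :=
  UniformSpace.Completion (TensorPow H n)

/-- The tensor product of `n` bounded operators on the Hilbert tensor power. -/
def hTensorMap (n : ℕ) (B : Fin n → H →L[ℂ] H) : HTensorPow H n →L[ℂ] HTensorPow H n :=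
  (tensorPowMap n B).completion

/-- The product tensor in the Hilbert tensor power. -/
def hTprod (n : ℕ) (v : Fin n → H) : HTensorPow H n := (tprod n v : TensorPow H n)

theorem hTensorMap_hTprod (n : ℕ) (B : Fin n → H →L[ℂ] H) (v : Fin n → H) :
    hTensorMap n B (hTprod n v) = hTprod n fun i => B i (v i) := by
  rw [hTensorMap, hTprod, ContinuousLinearMap.completion_apply_coe, tensorPowMap_tprod]
  rfl

theorem norm_hTensorMap_le (n : ℕ) (B : Fin n → H →L[ℂ] H) :
    ‖hTensorMap n B‖ ≤ ∏ i, ‖B i‖ := by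
  refine le_trans ?_ (norm_tensorPowMap_le n B)
  refine ContinuousLinearMap.opNorm_le_bound _ (norm_nonneg _) fun x => ?_
  induction x using UniformSpace.Completion.induction_on with
  | hp => exact isClosed_le (by fun_prop) (by fun_prop)
  | ih a =>
    rw [hTensorMap, ContinuousLinearMap.completion_apply_coe, UniformSpace.Completion.norm_coe,
      UniformSpace.Completion.norm_coe]
    exact ContinuousLinearMap.le_opNorm _ _

theorem hTensorPow_induction {n : ℕ} {p : HTensorPow H n → Prop} (hc : IsClosed {x | p x})
    (h : ∀ v, p (hTprod n v)) (h0 : p 0) (hadd : ∀ x y, p x → p y → p (x + y))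
    (hsmul : ∀ (c : ℂ) x, p x → p (c • x)) (x : HTensorPow H n) : p x := by
  induction x using UniformSpace.Completion.induction_on with
  | hp => exact hc
  | ih a =>
    have ha : a ∈ Submodule.span ℂ (Set.range (tprod (H := H) n)) :=
      span_range_tprod (H := H) n ▸ Submodule.mem_top
    induction ha using Submodule.span_induction with
    | mem b hb =>
      obtain ⟨v, rfl⟩ := hb
      exact h v
    | zero => exact h0
    | add b c _ _ hb hc =>
      rw [UniformSpace.Completion.coe_add]
      exact hadd _ _ hb hc
    | smul r b _ hb =>
      rw [UniformSpace.Completion.coe_smul]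
      exact hsmul _ _ hb

theorem hTensorMap_ext {n : ℕ} {S T : HTensorPow H n →L[ℂ] HTensorPow H n}
    (h : ∀ v, S (hTprod n v) = T (hTprod n v)) : S = T := by
  ext x
  refine hTensorPow_induction (p := fun x => S x = T x) (isClosed_eq S.continuous T.continuous) h
    (by simp) (fun x y hx hy => by simp only [map_add, hx, hy])
    (fun c x hx => by simp only [map_smul, hx]) x

theorem hTensorMap_mul (n : ℕ) (B D : Fin n → H →L[ℂ] H) :
    hTensorMap n B * hTensorMap n D = hTensorMap n (B * D) :=
  hTensorMap_ext fun v => by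
    rw [mul_apply_eq_comp, hTensorMap_hTprod, hTensorMap_hTprod, hTensorMap_hTprod]
    rfl

theorem hTensorMap_update_sub (n : ℕ) (B : Fin n → H →L[ℂ] H) (i : Fin n) (C D : H →L[ℂ] H) :
    hTensorMap n (Function.update B i (C - D)) =
      hTensorMap n (Function.update B i C) - hTensorMap n (Function.update B i D) :=
  hTensorMap_ext fun v => by
    have key : ∀ T : H →L[ℂ] H, (fun j => Function.update B i T j (v j)) =
        Function.update (fun j => B j (v j)) i (T (v i)) := by
      intro T
      ext j
      by_cases hj : j = i
      · subst hj
        simp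
      · simp [hj]
    rw [sub_apply, hTensorMap_hTprod, hTensorMap_hTprod, hTensorMap_hTprod, key, key, key, hTprod,
      sub_apply, tprod_update_sub, UniformSpace.Completion.coe_sub]
    rfl

theorem inner_hTprod (n : ℕ) (v w : Fin n → H) :
    (inner ℂ (hTprod n v) (hTprod n w) : ℂ) = ∏ i, inner ℂ (v i) (w i) := by
  rw [hTprod, hTprod, UniformSpace.Completion.inner_coe, inner_tprod]

theorem eq_zero_of_inner_hTprod {n : ℕ} {x : HTensorPow H n}
    (h : ∀ v, (inner ℂ (hTprod n v) x : ℂ) = 0) : x = 0 := by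
  rw [← inner_self_eq_zero (𝕜 := ℂ)]
  refine hTensorPow_induction (p := fun y => (inner ℂ y x : ℂ) = 0)
    (isClosed_eq (by fun_prop) (by fun_prop)) h (by simp)
    (fun a b ha hb => by rw [inner_add_left, ha, hb, add_zero])
    (fun c a ha => by rw [inner_smul_left, ha, mul_zero]) x

variable [CompleteSpace H]

theorem inner_hTensorMap {n : ℕ} {B : Fin n → H →L[ℂ] H} (hB : ∀ i, IsSelfAdjoint (B i))
    (x y : HTensorPow H n) :
    (inner ℂ (hTensorMap n B x) y : ℂ) = inner ℂ x (hTensorMap n B y) := by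
  refine hTensorPow_induction
    (p := fun x => (inner ℂ (hTensorMap n B x) y : ℂ) = inner ℂ x (hTensorMap n B y))
    (isClosed_eq (by fun_prop) (by fun_prop)) (fun v => ?_) (by simp)
    (fun a b ha hb => by rw [map_add, inner_add_left, inner_add_left, ha, hb])
    (fun c a ha => by rw [map_smul, inner_smul_left, inner_smul_left, ha]) x
  refine hTensorPow_induction
    (p := fun y => (inner ℂ (hTensorMap n B (hTprod n v)) y : ℂ) =
      inner ℂ (hTprod n v) (hTensorMap n B y))
    (isClosed_eq (by fun_prop) (by fun_prop)) (fun w => ?_) (by simp)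
    (fun a b ha hb => by rw [map_add, inner_add_right, inner_add_right, ha, hb])
    (fun c a ha => by rw [map_smul, inner_smul_right, inner_smul_right, ha]) y
  rw [hTensorMap_hTprod, hTensorMap_hTprod, inner_hTprod, inner_hTprod]
  exact Finset.prod_congr rfl fun i _ => (hB i).inner_symm _ _

/-- The common source of the positivity statements about tensor operators: a factorwise square root
`P` of `B D` exhibits the inner product as a squared norm. -/
theorem inner_hTensorMap_eq_norm_sq {n : ℕ} {B D P : Fin n → H →L[ℂ] H}
    (hB : ∀ i, IsSelfAdjoint (B i)) (hP : ∀ i, IsSelfAdjoint (P i))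
    (h : ∀ i, B i * D i = P i * P i) (x : HTensorPow H n) :
    (inner ℂ (hTensorMap n B x) (hTensorMap n D x) : ℂ) = ((‖hTensorMap n P x‖ ^ 2 : ℝ) : ℂ) := by
  rw [inner_hTensorMap hB, ← mul_apply_eq_comp, hTensorMap_mul, (funext h : B * D = P * P),
    ← hTensorMap_mul, mul_apply_eq_comp, ← inner_hTensorMap hP, inner_self_eq_norm_sq_to_K]
  push_cast
  rfl

/-- Injective self-adjoint factors have dense range, so by continuity of the product tensor a kernel
vector, orthogonal to every `⊗ Bᵢ wᵢ`, is orthogonal to every product tensor. -/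
theorem hTensorMap_injective {n : ℕ} {B : Fin n → H →L[ℂ] H} (hB : ∀ i, IsSelfAdjoint (B i))
    (h : ∀ i y, B i y = 0 → y = 0) {x : HTensorPow H n} (hx : hTensorMap n B x = 0) : x = 0 := by
  have hdense : ∀ i, DenseRange (B i) := fun i => by
    have : Dense ((LinearMap.range (B i : H →ₗ[ℂ] H) : Submodule ℂ H) : Set H) :=
      Submodule.dense_of_inner fun y hy => h i y <| by
        have h1 := hy (B i (B i y)) ⟨_, rfl⟩
        rw [(hB i).inner_symm, inner_self_eq_zero] at h1
        exact h1
    rwa [LinearMap.coe_range] at this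
  have hd : DenseRange (Pi.map fun i => (B i : H → H)) := DenseRange.piMap hdense
  refine eq_zero_of_inner_hTprod fun v => ?_
  refine hd.induction_on (p := fun v => (inner ℂ (hTprod n v) x : ℂ) = 0) v ?_ fun w => ?_
  · refine isClosed_eq (Continuous.inner ?_ continuous_const) continuous_const
    exact UniformSpace.Completion.continuous_coe _ |>.comp (continuous_tprod n)
  · have : hTprod n (Pi.map (fun i => (B i : H → H)) w) = hTensorMap n B (hTprod n w) := by
      rw [hTensorMap_hTprod]
      rfl
    rw [this, inner_hTensorMap hB, hx, inner_zero_right]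

end TensorPow

/-! ### Second quantization and the comparison of resolvents -/

section SecondQuantization

universe u

variable {H : Type u} [NormedAddCommGroup H] [InnerProductSpace ℂ H]

/-- The operator `C ⊗ ⋯ ⊗ C`. -/
def tensorDiag (C : H →L[ℂ] H) (n : ℕ) : HTensorPow H n →L[ℂ] HTensorPow H n :=
  hTensorMap n fun _ => C

/-- The operator `C ⊗ ⋯ ⊗ 1 ⊗ ⋯ ⊗ C`, with `1` acting on the `i`-th factor. -/
def tensorOmit (C : H →L[ℂ] H) (n : ℕ) (i : Fin n) : HTensorPow H n →L[ℂ] HTensorPow H n :=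
  hTensorMap n (Function.update (fun _ => C) i 1)

/-- The operator `∑ᵢ C ⊗ ⋯ ⊗ 1 ⊗ ⋯ ⊗ C`. -/
def tensorOmitSum (C : H →L[ℂ] H) (n : ℕ) : HTensorPow H n →L[ℂ] HTensorPow H n :=
  ∑ i, tensorOmit C n i

theorem tensorDiag_symTprod (C : H →L[ℂ] H) (n : ℕ) (v : Fin n → H) :
    tensorDiag C n (symTprod n v) = symTprod n fun j => C (v j) := by
  change tensorDiag C n (_ • ∑ σ : Equiv.Perm (Fin n), hTprod n (v ∘ σ)) =
    _ • ∑ σ : Equiv.Perm (Fin n), hTprod n ((fun j => C (v j)) ∘ σ)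
  rw [map_smul, map_sum]
  congr 1
  refine Finset.sum_congr rfl fun σ _ => ?_
  rw [tensorDiag, hTensorMap_hTprod]
  rfl

theorem tensorOmitSum_symTprod (C : H →L[ℂ] H) (n : ℕ) (v : Fin n → H) :
    tensorOmitSum C n (symTprod n v) =
      ∑ i, symTprod n (Function.update (fun j => C (v j)) i (v i)) := by
  change tensorOmitSum C n (_ • ∑ σ : Equiv.Perm (Fin n), hTprod n (v ∘ σ)) =
    ∑ i, _ • ∑ σ : Equiv.Perm (Fin n), hTprod n (Function.update (fun j => C (v j)) i (v i) ∘ σ)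
  rw [map_smul, map_sum, ← Finset.smul_sum, Finset.sum_comm]
  congr 1
  refine Finset.sum_congr rfl fun σ _ => ?_
  rw [tensorOmitSum, sum_apply]
  -- A single omitted slot is moved by `σ`; only the sum over all slots is compatible with
  -- symmetrization.
  conv_rhs => rw [← Equiv.sum_comp σ]
  refine Finset.sum_congr rfl fun i _ => ?_
  rw [tensorOmit, hTensorMap_hTprod]
  congr 1
  ext j
  by_cases hj : j = i
  · subst hj
    simp
  · simp [hj]

theorem norm_hTensorMap_update_one_le (n : ℕ) (i : Fin n) (D : H →L[ℂ] H) :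
    ‖hTensorMap n (Function.update 1 i D)‖ ≤ ‖D‖ := by
  refine (norm_hTensorMap_le n _).trans ?_
  rw [← Finset.mul_prod_erase _ _ (Finset.mem_univ i), Function.update_self]
  refine mul_le_of_le_one_right (norm_nonneg _) (Finset.prod_le_one (fun _ _ => norm_nonneg _) ?_)
  intro j hj
  rw [Function.update_of_ne (Finset.ne_of_mem_erase hj)]
  exact ContinuousLinearMap.norm_id_le

theorem tensorDiag_eq_mul_tensorOmit (C : H →L[ℂ] H) (n : ℕ) (i : Fin n) :
    tensorDiag C n = hTensorMap n (Function.update 1 i C) * tensorOmit C n i := by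
  rw [tensorDiag, tensorOmit, hTensorMap_mul]
  congr 1
  ext1 j
  by_cases hj : j = i
  · subst hj
    simp
  · simp [hj]

/-- Orthogonality passes from the generators to the whole closed sector, hence to `x` itself. No
invariance of the sector under `W` is needed. -/
theorem inner_apply_self_eq_zero_of_symTprod {n : ℕ} (W : HTensorPow H n →L[ℂ] HTensorPow H n)
    {x : HTensorPow H n} (hx : x ∈ bosonSector H n)
    (h : ∀ v, (inner ℂ (W (symTprod n v)) x : ℂ) = 0) : (inner ℂ (W x) x : ℂ) = 0 := by
  let K : Submodule ℂ (HTensorPow H n) := LinearMap.ker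
    ((innerSL ℂ x).comp W : HTensorPow H n →ₗ[ℂ] ℂ)
  have hK : IsClosed (K : Set (HTensorPow H n)) := ((innerSL ℂ x).comp W).isClosed_ker
  have hle : bosonSector H n ≤ K := by
    refine Submodule.topologicalClosure_minimal _ (Submodule.span_le.2 ?_) hK
    rintro _ ⟨v, rfl⟩
    exact inner_eq_zero_symm.1 (h v)
  exact inner_eq_zero_symm.1 (hle hx)

theorem mem_dGammaGraph_of_isResolventAt {A : H →ₗ.[ℂ] H} {C : H →L[ℂ] H}
    (hA : IsResolventAt A 0 C) (n : ℕ) (u : Fin n → H) :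
    (fockProd n (fun j => C (u j)),
      ∑ i, fockProd n (Function.update (fun j => C (u j)) i (u i))) ∈ dGammaGraph A := by
  choose hd hv using fun j => hA.1 (u j)
  refine Submodule.subset_span ⟨n, fun j => ⟨C (u j), hd j⟩, ?_⟩
  simp only [zero_smul, sub_zero] at hv
  simp only [hv]

/-- The passage from unbounded to bounded operators: in each sector the graph pair comes from one
vector `x`, morally `A^{⊗n}` applied to the first component, so later estimates involve only `C =
A⁻¹`. -/
theorem exists_of_mem_dGammaGraph {A : H →ₗ.[ℂ] H} {C : H →L[ℂ] H}
    (hA : IsResolventAt A 0 C) {p : Fock H × Fock H} (hp : p ∈ dGammaGraph A) (n : ℕ) :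
    ∃ x : HTensorPow H n, (p.1 n : HTensorPow H n) = tensorDiag C n x ∧
      (p.2 n : HTensorPow H n) = tensorOmitSum C n x := by
  induction hp using Submodule.span_induction with
  | mem p hp =>
    obtain ⟨m, v, rfl⟩ := hp
    by_cases hnm : n = m
    · subst hnm
      have hv : ∀ j, C (A (v j)) = v j := fun j => by simpa using hA.2 (v j)
      refine ⟨symTprod n fun j => A (v j), ?_, ?_⟩
      · rw [tensorDiag_symTprod]
        simp only [hv, fockProd, lp.single_apply_self]
      · rw [tensorOmitSum_symTprod]
        simp only [hv, fockProd, lp.coeFn_sum, Finset.sum_apply, lp.single_apply_self,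
          Submodule.coe_sum]
    · refine ⟨0, ?_, ?_⟩
      · simp only [fockProd, lp.single_apply_ne _ _ _ hnm, map_zero, Submodule.coe_zero]
      · simp only [fockProd, lp.coeFn_sum, Finset.sum_apply, lp.single_apply_ne _ _ _ hnm, map_zero,
          Finset.sum_const_zero, Submodule.coe_zero]
  | zero => exact ⟨0, by simp, by simp⟩
  | add p q _ _ hp hq =>
    obtain ⟨x, hx, hx'⟩ := hp
    obtain ⟨y, hy, hy'⟩ := hq
    refine ⟨x + y, ?_, ?_⟩
    · rw [map_add, ← hx, ← hy]
      rfl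
    · rw [map_add, ← hx', ← hy']
      rfl
  | smul c p _ hp =>
    obtain ⟨x, hx, hx'⟩ := hp
    refine ⟨c • x, ?_, ?_⟩
    · rw [map_smul, ← hx]
      rfl
    · rw [map_smul, ← hx']
      rfl

theorem inner_fockProd_left (n : ℕ) (v : Fin n → H) (ψ : Fock H) :
    (inner ℂ (fockProd n v) ψ : ℂ) = inner ℂ (symTprod n v) (ψ n : HTensorPow H n) := by
  rw [fockProd, lp.inner_single_left, Submodule.coe_inner]

variable [CompleteSpace H]

theorem _root_.IsSelfAdjoint.of_mul_self_eq {C E : H →L[ℂ] H} (hE : IsSelfAdjoint E)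
    (hC : E * E = C) : IsSelfAdjoint C := by
  rw [← hC, ← sq]
  exact hE.pow 2

theorem isSelfAdjoint_update {n : ℕ} {B : Fin n → H →L[ℂ] H} (hB : ∀ i, IsSelfAdjoint (B i))
    {D : H →L[ℂ] H} (hD : IsSelfAdjoint D) (i j : Fin n) :
    IsSelfAdjoint (Function.update B i D j) := by
  by_cases hj : j = i
  · subst hj
    simpa using hD
  · simpa [hj] using hB j

theorem inner_tensorDiag_tensorOmitSum {C : H →L[ℂ] H} (hC : IsSelfAdjoint C) {n : ℕ}
    (x y : HTensorPow H n) :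
    (inner ℂ (tensorDiag C n x) (tensorOmitSum C n y) : ℂ) =
      inner ℂ (tensorOmitSum C n x) (tensorDiag C n y) := by
  rw [tensorOmitSum, sum_apply, sum_apply, inner_sum, sum_inner]
  refine Finset.sum_congr rfl fun i _ => ?_
  rw [tensorDiag, tensorOmit, inner_hTensorMap fun _ => hC,
    inner_hTensorMap (isSelfAdjoint_update (fun _ => hC) (IsSelfAdjoint.one _) i),
    ← mul_apply_eq_comp, ← mul_apply_eq_comp, hTensorMap_mul, hTensorMap_mul]
  congr 3
  ext1 j
  by_cases hj : j = i
  · subst hj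
    simp
  · simp [hj]

theorem inner_tensorDiag_self {C E : H →L[ℂ] H} (hE : IsSelfAdjoint E) (hC : E * E = C) {n : ℕ}
    (x : HTensorPow H n) :
    (inner ℂ (tensorDiag C n x) x : ℂ) = ((‖tensorDiag E n x‖ ^ 2 : ℝ) : ℂ) := by
  have h1 : hTensorMap n (fun _ => (1 : H →L[ℂ] H)) x = x := by
    have : hTensorMap n (fun _ => (1 : H →L[ℂ] H)) = ContinuousLinearMap.id ℂ _ :=
      hTensorMap_ext fun v => by
        rw [hTensorMap_hTprod]
        rfl
    rw [this]
    rfl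
  have := inner_hTensorMap_eq_norm_sq (n := n) (B := fun _ => C) (D := fun _ => 1) (P := fun _ => E)
    (fun _ => hE.of_mul_self_eq hC) (fun _ => hE) (fun i => by simp [hC]) x
  rwa [h1] at this

theorem inner_tensorDiag_tensorOmit {C E : H →L[ℂ] H} (hE : IsSelfAdjoint E) (hC : E * E = C)
    {n : ℕ} (x : HTensorPow H n) (i : Fin n) :
    (inner ℂ (tensorDiag C n x) (tensorOmit C n i x) : ℂ) =
      ((‖hTensorMap n (Function.update (fun _ => C) i E) x‖ ^ 2 : ℝ) : ℂ) := by
  have hCs := hE.of_mul_self_eq hC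
  refine inner_hTensorMap_eq_norm_sq (fun _ => hCs)
    (isSelfAdjoint_update (fun _ => hCs) hE i) (fun j => ?_) x
  by_cases hj : j = i
  · subst hj
    simp [hC]
  · simp [hj]

theorem inner_tensorOmit_self {C E : H →L[ℂ] H} (hE : IsSelfAdjoint E) (hC : E * E = C)
    {n : ℕ} (x : HTensorPow H n) (i : Fin n) :
    (inner ℂ (tensorOmit C n i x) x : ℂ) = ((‖tensorOmit E n i x‖ ^ 2 : ℝ) : ℂ) := by
  have h1 : tensorOmit C n i = tensorOmit E n i * tensorOmit E n i := by
    rw [tensorOmit, tensorOmit, hTensorMap_mul]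
    congr 1
    ext1 j
    by_cases hj : j = i
    · subst hj
      simp
    · simp [hj, hC]
  rw [h1, mul_apply_eq_comp, tensorOmit,
    inner_hTensorMap (isSelfAdjoint_update (fun _ => hE) (IsSelfAdjoint.one _) i),
    inner_self_eq_norm_sq_to_K]
  push_cast
  rfl

/-- The cross term `⟨AᵢΦ, AⱼΦ⟩` is nonnegative: the factors multiply to `C` in slots `i` and `j` and
to `C²` elsewhere, whose square roots are `E` and `C`. -/
theorem inner_tensorOmit_tensorOmit {C E : H →L[ℂ] H} (hE : IsSelfAdjoint E) (hC : E * E = C)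
    {n : ℕ} (x : HTensorPow H n) {i j : Fin n} (hij : i ≠ j) :
    (inner ℂ (tensorOmit C n i x) (tensorOmit C n j x) : ℂ) =
      ((‖hTensorMap n (Function.update (Function.update (fun _ => C) i E) j E) x‖ ^ 2 : ℝ) : ℂ) := by
  have hCs := hE.of_mul_self_eq hC
  refine inner_hTensorMap_eq_norm_sq (isSelfAdjoint_update (fun _ => hCs) (IsSelfAdjoint.one _) i)
    (isSelfAdjoint_update (isSelfAdjoint_update (fun _ => hCs) hE i) hE j) (fun k => ?_) x
  by_cases hj : k = j
  · subst hj
    simp [hC, hij.symm]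
  · by_cases hi : k = i
    · subst hi
      simp [hC, hj]
    · simp [hi, hj]

theorem re_inner_tensorDiag_tensorOmitSum_nonneg {C E : H →L[ℂ] H} (hE : IsSelfAdjoint E)
    (hC : E * E = C) {n : ℕ} (x : HTensorPow H n) :
    0 ≤ (inner ℂ (tensorDiag C n x) (tensorOmitSum C n x) : ℂ).re := by
  rw [tensorOmitSum, sum_apply, inner_sum, Complex.re_sum]
  refine Finset.sum_nonneg fun i _ => ?_
  rw [inner_tensorDiag_tensorOmit hE hC, Complex.ofReal_re]
  positivity

/-- Expand the square of the sum and drop the nonnegative cross terms. This keeps the comparison of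
resolvents uniform in the particle number. -/
theorem sum_norm_sq_tensorOmit_le {C E : H →L[ℂ] H} (hE : IsSelfAdjoint E)
    (hC : E * E = C) {n : ℕ} (x : HTensorPow H n) :
    ∑ i, ‖tensorOmit C n i x‖ ^ 2 ≤ ‖tensorOmitSum C n x‖ ^ 2 := by
  rw [← inner_self_eq_norm_sq (𝕜 := ℂ) (tensorOmitSum C n x), tensorOmitSum, sum_apply, sum_inner,
    map_sum]
  refine Finset.sum_le_sum fun i _ => ?_
  rw [inner_sum, map_sum, ← inner_self_eq_norm_sq (𝕜 := ℂ)]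
  refine Finset.single_le_sum
    (f := fun j => RCLike.re (inner ℂ (tensorOmit C n i x) (tensorOmit C n j x) : ℂ))
    (fun j _ => ?_) (Finset.mem_univ i)
  by_cases hij : i = j
  · subst hij
    exact inner_self_nonneg
  · rw [inner_tensorOmit_tensorOmit hE hC x hij]
    exact (sq_nonneg _).trans_eq (Complex.ofReal_re _).symm

/-- Extracting `C'` and `C` from slot `i` leaves `(C' - C)ᵢ` between the two omitted products;
Cauchy–Schwarz over `i` and `sum_norm_sq_tensorOmit_le` finish. -/
theorem norm_inner_tensorDiag_sub_le {C E C' E' : H →L[ℂ] H} (hE : IsSelfAdjoint E)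
    (hC : E * E = C) (hE' : IsSelfAdjoint E') (hC' : E' * E' = C') {n : ℕ}
    (x y : HTensorPow H n) :
    ‖(inner ℂ (tensorDiag C' n x) (tensorOmitSum C n y) : ℂ) -
      inner ℂ (tensorOmitSum C' n x) (tensorDiag C n y)‖ ≤
      ‖C' - C‖ * (‖tensorOmitSum C' n x‖ * ‖tensorOmitSum C n y‖) := by
  have hCs' := hE'.of_mul_self_eq hC'
  have key : ∀ i, ‖(inner ℂ (tensorDiag C' n x) (tensorOmit C n i y) : ℂ) -
      inner ℂ (tensorOmit C' n i x) (tensorDiag C n y)‖ ≤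
      ‖C' - C‖ * (‖tensorOmit C' n i x‖ * ‖tensorOmit C n i y‖) := by
    intro i
    rw [tensorDiag_eq_mul_tensorOmit C' n i, tensorDiag_eq_mul_tensorOmit C n i,
      mul_apply_eq_comp, mul_apply_eq_comp,
      inner_hTensorMap (isSelfAdjoint_update (B := 1) (fun _ => IsSelfAdjoint.one _) hCs' i),
      ← inner_sub_right, ← sub_apply, ← hTensorMap_update_sub]
    refine (norm_inner_le_norm _ _).trans ?_
    rw [mul_left_comm]
    gcongr
    refine (ContinuousLinearMap.le_opNorm _ _).trans ?_
    gcongr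
    exact norm_hTensorMap_update_one_le n i _
  have e1 : (inner ℂ (tensorDiag C' n x) (tensorOmitSum C n y) : ℂ) -
      inner ℂ (tensorOmitSum C' n x) (tensorDiag C n y) =
      ∑ i, ((inner ℂ (tensorDiag C' n x) (tensorOmit C n i y) : ℂ) -
        inner ℂ (tensorOmit C' n i x) (tensorDiag C n y)) := by
    rw [tensorOmitSum, tensorOmitSum, sum_apply, sum_apply, inner_sum, sum_inner,
      Finset.sum_sub_distrib]
  rw [e1]
  refine (norm_sum_le _ _).trans ((Finset.sum_le_sum fun i _ => key i).trans ?_)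
  rw [← Finset.mul_sum]
  gcongr
  refine (Real.sum_mul_le_sqrt_mul_sqrt _ _ _).trans ?_
  gcongr
  · exact Real.sqrt_le_iff.2 ⟨norm_nonneg _, sum_norm_sq_tensorOmit_le hE' hC' x⟩
  · exact Real.sqrt_le_iff.2 ⟨norm_nonneg _, sum_norm_sq_tensorOmit_le hE hC y⟩

theorem inner_symm_of_mem_dGammaGraph {A : H →ₗ.[ℂ] H} {C : H →L[ℂ] H}
    (hA : IsResolventAt A 0 C) (hC : IsSelfAdjoint C) {p q : Fock H × Fock H}
    (hp : p ∈ dGammaGraph A) (hq : q ∈ dGammaGraph A) :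
    (inner ℂ p.1 q.2 : ℂ) = inner ℂ p.2 q.1 := by
  rw [lp.inner_eq_tsum, lp.inner_eq_tsum]
  refine tsum_congr fun n => ?_
  obtain ⟨x, hx, hx'⟩ := exists_of_mem_dGammaGraph hA hp n
  obtain ⟨y, hy, hy'⟩ := exists_of_mem_dGammaGraph hA hq n
  rw [Submodule.coe_inner, Submodule.coe_inner, hx, hx', hy, hy',
    inner_tensorDiag_tensorOmitSum hC]

theorem re_inner_nonneg_of_mem_dGammaGraph {A : H →ₗ.[ℂ] H} {C E : H →L[ℂ] H}
    (hA : IsResolventAt A 0 C) (hE : IsSelfAdjoint E) (hC : E * E = C) {p : Fock H × Fock H}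
    (hp : p ∈ dGammaGraph A) : 0 ≤ (inner ℂ p.1 p.2 : ℂ).re := by
  refine (Complex.hasSum_re (lp.hasSum_inner p.1 p.2)).nonneg fun n => ?_
  obtain ⟨x, hx, hx'⟩ := exists_of_mem_dGammaGraph hA hp n
  rw [Submodule.coe_inner, hx, hx']
  exact re_inner_tensorDiag_tensorOmitSum_nonneg hE hC x

theorem norm_inner_sub_le_of_mem_dGammaGraph {A A' : H →ₗ.[ℂ] H} {C E C' E' : H →L[ℂ] H}
    (hA : IsResolventAt A 0 C) (hE : IsSelfAdjoint E) (hC : E * E = C)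
    (hA' : IsResolventAt A' 0 C') (hE' : IsSelfAdjoint E') (hC' : E' * E' = C')
    {p q : Fock H × Fock H} (hp : p ∈ dGammaGraph A') (hq : q ∈ dGammaGraph A) :
    ‖(inner ℂ p.1 q.2 : ℂ) - inner ℂ p.2 q.1‖ ≤ ‖C' - C‖ * (‖p.2‖ * ‖q.2‖) := by
  have hs₁ : HasSum (fun n => (inner ℂ (p.1 n) (q.2 n) : ℂ)) (inner ℂ p.1 q.2) :=
    lp.hasSum_inner p.1 q.2
  have hs₂ : HasSum (fun n => (inner ℂ (p.2 n) (q.1 n) : ℂ)) (inner ℂ p.2 q.1) :=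
    lp.hasSum_inner p.2 q.1
  have hs := hs₁.sub hs₂
  have h22 : (2 : ENNReal).toReal.HolderConjugate (2 : ENNReal).toReal := by
    rw [ENNReal.toReal_ofNat]
    exact Real.HolderConjugate.two_two
  obtain ⟨hmul, hmul'⟩ : (Summable fun n => ‖p.2 n‖ * ‖q.2 n‖) ∧
      ∑' n, ‖p.2 n‖ * ‖q.2 n‖ ≤ ‖p.2‖ * ‖q.2‖ := lp.tsum_mul_le_mul_norm h22 p.2 q.2
  have hb := hmul.hasSum.mul_left ‖C' - C‖
  rw [← hs.tsum_eq]
  refine (tsum_of_norm_bounded hb fun n => ?_).trans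
    (mul_le_mul_of_nonneg_left hmul' (norm_nonneg _))
  obtain ⟨x, hx, hx'⟩ := exists_of_mem_dGammaGraph hA' hp n
  obtain ⟨y, hy, hy'⟩ := exists_of_mem_dGammaGraph hA hq n
  rw [Submodule.coe_inner, Submodule.coe_inner, Submodule.coe_norm, Submodule.coe_norm, hx, hx',
    hy, hy']
  exact norm_inner_tensorDiag_sub_le hE hC hE' hC' x y

theorem eq_zero_of_inner_dGammaGraph_fst {A : H →ₗ.[ℂ] H} {C E : H →L[ℂ] H}
    (hA : IsResolventAt A 0 C) (hE : IsSelfAdjoint E) (hC : E * E = C) {ψ : Fock H}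
    (h : ∀ p ∈ dGammaGraph A, (inner ℂ p.1 ψ : ℂ) = 0) : ψ = 0 := by
  ext n
  have h1 := inner_apply_self_eq_zero_of_symTprod (tensorDiag C n) (ψ n).2 fun v => by
    have := h _ (mem_dGammaGraph_of_isResolventAt hA n v)
    rwa [inner_fockProd_left, ← tensorDiag_symTprod] at this
  rw [inner_tensorDiag_self hE hC, Complex.ofReal_eq_zero, sq_eq_zero_iff, norm_eq_zero] at h1
  refine hTensorMap_injective (fun _ => hE) (fun _ y hy => hA.injective y ?_) h1
  rw [← hC, mul_apply_eq_comp, hy, map_zero]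

/-- Essential self-adjointness: the range of `dΓ(A) + 1` on the algebraic domain is dense. Each
component of an orthogonal `ψ` satisfies `‖E^{⊗n} ψₙ‖² + ∑ᵢ ‖⋯‖² = 0`, and `E^{⊗n}` is injective. -/
theorem eq_zero_of_inner_dGammaGraph_add {A : H →ₗ.[ℂ] H} {C E : H →L[ℂ] H}
    (hA : IsResolventAt A 0 C) (hE : IsSelfAdjoint E) (hC : E * E = C) {ψ : Fock H}
    (h : ∀ p ∈ dGammaGraph A, (inner ℂ (p.1 + p.2) ψ : ℂ) = 0) : ψ = 0 := by
  ext n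
  have h1 := inner_apply_self_eq_zero_of_symTprod (tensorDiag C n + tensorOmitSum C n) (ψ n).2
    fun v => by
      have := h _ (mem_dGammaGraph_of_isResolventAt hA n v)
      rw [inner_add_left, sum_inner] at this
      simp only [inner_fockProd_left] at this
      rwa [← tensorDiag_symTprod, ← sum_inner, ← tensorOmitSum_symTprod, ← inner_add_left] at this
  rw [add_apply, inner_add_left, inner_tensorDiag_self hE hC, tensorOmitSum, sum_apply,
    sum_inner] at h1
  simp only [inner_tensorOmit_self hE hC] at h1
  rw [← Complex.ofReal_sum, ← Complex.ofReal_add, Complex.ofReal_eq_zero] at h1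
  -- The first summand is the one to keep: it also covers the vacuum sector `n = 0`, where the sum
  -- over slots is empty.
  have h2 := ((add_eq_zero_iff_of_nonneg (by positivity) (by positivity)).1 h1).1
  rw [sq_eq_zero_iff, norm_eq_zero] at h2
  refine hTensorMap_injective (fun _ => hE) (fun _ y hy => hA.injective y ?_) h2
  rw [← hC, mul_apply_eq_comp, hy, map_zero]

/-- The inverse of `dΓ(A) + 1`, for `A` with a positive bounded inverse. -/
theorem exists_isResolventAt_dGamma {A : H →ₗ.[ℂ] H} {C : H →L[ℂ] H}
    (hA : IsResolventAt A 0 C) (hC : 0 ≤ C) :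
    ∃ M : Fock H →L[ℂ] Fock H, IsSelfAdjoint M ∧ IsResolventAt (dGamma A) ((-1 : ℝ) : ℂ) M ∧
      ∀ p ∈ dGammaGraph A, M (p.1 + p.2) = p.1 := by
  have hE := ((ContinuousLinearMap.nonneg_iff_isPositive _).1 (CFC.sqrt_nonneg C)).isSelfAdjoint
  have hEC := CFC.sqrt_mul_sqrt_self C hC
  exact exists_isResolventAt_friedrichs
    (fun p hp q hq => inner_symm_of_mem_dGammaGraph hA (hE.of_mul_self_eq hEC) hp hq)
    (fun p hp => re_inner_nonneg_of_mem_dGammaGraph hA hE hEC hp)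
    (fun x hx => eq_zero_of_inner_dGammaGraph_fst hA hE hEC hx)
    (fun x hx => eq_zero_of_inner_dGammaGraph_add hA hE hEC hx)

theorem norm_sub_le_of_dGammaGraph {A A' : H →ₗ.[ℂ] H} {C C' : H →L[ℂ] H}
    (hA : IsResolventAt A 0 C) (hC : 0 ≤ C) (hA' : IsResolventAt A' 0 C') (hC' : 0 ≤ C')
    {M M' : Fock H →L[ℂ] Fock H} (hM' : IsSelfAdjoint M')
    (hMG : ∀ p ∈ dGammaGraph A, M (p.1 + p.2) = p.1)
    (hMG' : ∀ p ∈ dGammaGraph A', M' (p.1 + p.2) = p.1) : ‖M' - M‖ ≤ ‖C' - C‖ := by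
  have hE : ∀ C : H →L[ℂ] H, IsSelfAdjoint (CFC.sqrt C) := fun C =>
    ((ContinuousLinearMap.nonneg_iff_isPositive _).1 (CFC.sqrt_nonneg C)).isSelfAdjoint
  -- That is, `dΓ(A) (dΓ(A) + 1)⁻¹` is a contraction.
  have hle : ∀ {A : H →ₗ.[ℂ] H} {C : H →L[ℂ] H}, IsResolventAt A 0 C → 0 ≤ C →
      ∀ p ∈ dGammaGraph A, ‖p.2‖ ≤ ‖p.1 + p.2‖ := by
    intro A C hA hC p hp
    rw [← sq_le_sq₀ (norm_nonneg _) (norm_nonneg _), norm_add_sq (𝕜 := ℂ)]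
    have h1 : 0 ≤ RCLike.re (inner ℂ p.1 p.2 : ℂ) :=
      re_inner_nonneg_of_mem_dGammaGraph hA (hE C) (CFC.sqrt_mul_sqrt_self C hC) hp
    nlinarith [sq_nonneg ‖p.1‖]
  have hdense : ∀ {A : H →ₗ.[ℂ] H} {C : H →L[ℂ] H}, IsResolventAt A 0 C → 0 ≤ C →
      Dense (((dGammaGraph A).map (LinearMap.fst ℂ (Fock H) (Fock H) +
        LinearMap.snd ℂ (Fock H) (Fock H)) : Submodule ℂ (Fock H)) : Set (Fock H)) := by
    intro A C hA hC
    refine Submodule.dense_of_inner fun x hx => ?_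
    exact eq_zero_of_inner_dGammaGraph_add hA (hE C) (CFC.sqrt_mul_sqrt_self C hC)
      fun p hp => hx _ ⟨p, hp, rfl⟩
  have key : ∀ x y, ‖(inner ℂ x ((M' - M) y) : ℂ)‖ ≤ ‖C' - C‖ * (‖x‖ * ‖y‖) := by
    intro x y
    refine (hdense hA' hC').induction
      (P := fun x => ‖(inner ℂ x ((M' - M) y) : ℂ)‖ ≤ ‖C' - C‖ * (‖x‖ * ‖y‖)) ?_
      (isClosed_le (by fun_prop) (by fun_prop)) x
    rintro _ ⟨p, hp, rfl⟩
    refine (hdense hA hC).induction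
      (P := fun y => ‖(inner ℂ (p.1 + p.2) ((M' - M) y) : ℂ)‖ ≤ ‖C' - C‖ * (‖p.1 + p.2‖ * ‖y‖)) ?_
      (isClosed_le (by fun_prop) (by fun_prop)) y
    rintro _ ⟨q, hq, rfl⟩
    change ‖(inner ℂ (p.1 + p.2) ((M' - M) (q.1 + q.2)) : ℂ)‖ ≤
      ‖C' - C‖ * (‖p.1 + p.2‖ * ‖q.1 + q.2‖)
    -- The terms `⟨p.1, q.1⟩` cancel, leaving the difference of forms already estimated.
    have e : (inner ℂ (p.1 + p.2) ((M' - M) (q.1 + q.2)) : ℂ) =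
        inner ℂ p.1 q.2 - inner ℂ p.2 q.1 := by
      rw [sub_apply, inner_sub_right, ← hM'.inner_symm, hMG q hq, hMG' p hp, inner_add_left,
        inner_add_right]
      ring
    rw [e]
    refine (norm_inner_sub_le_of_mem_dGammaGraph hA (hE C) (CFC.sqrt_mul_sqrt_self C hC) hA' (hE C')
      (CFC.sqrt_mul_sqrt_self C' hC') hp hq).trans ?_
    gcongr
    · exact hle hA' hC' p hp
    · exact hle hA hC q hq
  refine ContinuousLinearMap.opNorm_le_bound _ (norm_nonneg _) fun y => ?_
  -- Testing the form bound against `(M' - M) y` gives the operator norm bound after division.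
  have h1 := key ((M' - M) y) y
  rw [inner_self_eq_norm_sq_to_K, norm_pow, RCLike.norm_ofReal, abs_norm] at h1
  rcases (norm_nonneg ((M' - M) y)).eq_or_lt with h0 | h0
  · rw [← h0]
    positivity
  · refine le_of_mul_le_mul_left ?_ h0
    linarith [h1]

theorem normResolventTendsto_dGamma {A : ℕ → H →ₗ.[ℂ] H} {B : H →ₗ.[ℂ] H}
    {C : ℕ → H →L[ℂ] H} {D : H →L[ℂ] H} (hA : ∀ n, IsResolventAt (A n) 0 (C n))
    (hB : IsResolventAt B 0 D) (hC : ∀ n, 0 ≤ C n) (hD : 0 ≤ D) (h : Tendsto C atTop (𝓝 D)) :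
    NormResolventTendsto (fun n => dGamma (A n)) (dGamma B) := by
  choose M hM hMr hMG using fun n => exists_isResolventAt_dGamma (hA n) (hC n)
  obtain ⟨N, hN, hNr, hNG⟩ := exists_isResolventAt_dGamma hB hD
  refine normResolventTendsto_of_tendsto hMr hNr hM hN ?_
  rw [tendsto_iff_norm_sub_tendsto_zero] at h ⊢
  exact squeeze_zero (fun _ => norm_nonneg _)
    (fun n => norm_sub_le_of_dGammaGraph hB hD (hA n) (hC n) (hM n) hNG (hMG n)) h

end SecondQuantization

/-! ### Rank-one perturbations of bounded inverses -/

section RankOne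

variable {E : Type*} [NormedAddCommGroup E] [InnerProductSpace ℂ E] [CompleteSpace E]

/-- The operator `O - a |g⟩⟨g|`. -/
def rankOneSub (O : E →L[ℂ] E) (a : ℂ) (g : E) : E →L[ℂ] E :=
  O - a • InnerProductSpace.rankOne ℂ g g

omit [CompleteSpace E] in
theorem rankOneSub_apply (O : E →L[ℂ] E) (a : ℂ) (g x : E) :
    rankOneSub O a g x = O x - (a * inner ℂ g x) • g := by
  rw [rankOneSub, sub_apply, smul_apply, InnerProductSpace.rankOne_apply, smul_smul]

/-- The Sherman–Morrison formula. -/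
theorem IsResolventAt.vadd_rankOne {T : E →ₗ.[ℂ] E} {O : E →L[ℂ] E} (hT : IsResolventAt T 0 O)
    (hO : IsSelfAdjoint O) (ψ : E) {a b : ℂ} (h₁ : a * (1 + b * inner ℂ ψ (O ψ)) = b)
    (h₂ : b * (1 - a * inner ℂ ψ (O ψ)) = a) :
    IsResolventAt ((b • InnerProductSpace.rankOne ℂ ψ ψ : E →L[ℂ] E).toLinearMap +ᵥ T) 0
      (rankOneSub O a (O ψ)) := by
  rw [isResolventAt_iff] at hT ⊢
  simp only [zero_smul, sub_zero] at hT ⊢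
  intro x y
  have hgr : (x, y) ∈ ((b • InnerProductSpace.rankOne ℂ ψ ψ : E →L[ℂ] E).toLinearMap +ᵥ T).graph ↔
      (x, y - (b * inner ℂ ψ x) • ψ) ∈ T.graph := by
    simp only [LinearPMap.mem_graph_iff]
    constructor
    · rintro ⟨v, rfl, hv⟩
      refine ⟨v, rfl, ?_⟩
      rw [← hv, LinearPMap.vadd_apply]
      simp [InnerProductSpace.rankOne_apply, smul_smul]
    · rintro ⟨v, rfl, hv⟩
      refine ⟨v, rfl, ?_⟩
      rw [LinearPMap.vadd_apply, hv]
      simp [InnerProductSpace.rankOne_apply, smul_smul]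
  rw [hgr, hT, rankOneSub_apply, map_sub, map_smul, hO.inner_symm]
  set c : ℂ := inner ℂ ψ (O ψ)
  constructor
  · intro h
    have h3 : (inner ℂ ψ x : ℂ) = inner ℂ ψ (O y) - b * inner ℂ ψ x * c := by
      conv_lhs => rw [h]
      rw [inner_sub_right, inner_smul_right]
    have h4 : b * inner ℂ ψ x = a * inner ℂ ψ (O y) := by
      linear_combination (-(inner ℂ ψ x)) * h₁ + a * h3
    rw [← h4]
    exact h
  · intro h
    have h3 : (inner ℂ ψ x : ℂ) = inner ℂ ψ (O y) - a * inner ℂ ψ (O y) * c := by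
      conv_lhs => rw [h]
      rw [inner_sub_right, inner_smul_right]
    have h4 : b * inner ℂ ψ x = a * inner ℂ ψ (O y) := by
      linear_combination (inner ℂ ψ (O y)) * h₂ + b * h3
    rw [h4]
    exact h

/-- For `a ≤ 0` both terms on the right are nonnegative, which yields positivity and, with `P`
injective, injectivity. -/
theorem inner_rankOneSub_self {O P : E →L[ℂ] E} (hP : IsSelfAdjoint P) (hO : P * P = O) (a : ℝ)
    (g x : E) : (inner ℂ (rankOneSub O a g x) x : ℂ) =
      ((‖P x‖ ^ 2 - a * ‖(inner ℂ g x : ℂ)‖ ^ 2 : ℝ) : ℂ) := by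
  rw [rankOneSub_apply, inner_sub_left, inner_smul_left, ← hO, mul_apply_eq_comp, hP.inner_symm,
    inner_self_eq_norm_sq_to_K, map_mul, Complex.conj_ofReal, mul_assoc,
    ← Complex.normSq_eq_conj_mul_self, Complex.normSq_eq_norm_sq]
  push_cast
  rfl

theorem rankOneSub_nonneg {O P : E →L[ℂ] E} (hP : IsSelfAdjoint P) (hO : P * P = O) {a : ℝ}
    (ha : a ≤ 0) (g : E) : 0 ≤ rankOneSub O a g := by
  rw [ContinuousLinearMap.nonneg_iff_isPositive, ContinuousLinearMap.isPositive_iff_complex]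
  intro x
  rw [inner_rankOneSub_self hP hO]
  rw [RCLike.re_eq_complex_re, Complex.ofReal_re]
  refine ⟨rfl, ?_⟩
  nlinarith [sq_nonneg ‖P x‖, sq_nonneg ‖(inner ℂ g x : ℂ)‖]

theorem rankOneSub_injective {O P : E →L[ℂ] E} (hP : IsSelfAdjoint P) (hO : P * P = O)
    (hP0 : ∀ x, P x = 0 → x = 0) {a : ℝ} (ha : a ≤ 0) (g x : E) (hx : rankOneSub O a g x = 0) :
    x = 0 := by
  have h := inner_rankOneSub_self hP hO a g x
  rw [hx, inner_zero_left, eq_comm, Complex.ofReal_eq_zero] at h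
  refine hP0 x (norm_eq_zero.1 (sq_eq_zero_iff.1 (le_antisymm ?_ (sq_nonneg _))))
  nlinarith [sq_nonneg ‖(inner ℂ g x : ℂ)‖]

omit [CompleteSpace E] in
theorem tendsto_rankOneSub (O : E →L[ℂ] E) (a : ℂ) {γ : ℕ → E} {g : E}
    (h : Tendsto γ atTop (𝓝 g)) :
    Tendsto (fun n => rankOneSub O a (γ n)) atTop (𝓝 (rankOneSub O a g)) := by
  refine tendsto_const_nhds.sub (Tendsto.const_smul ?_ a)
  rw [tendsto_iff_norm_sub_tendsto_zero] at h ⊢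
  have h' := (tendsto_iff_norm_sub_tendsto_zero.2 h).norm
  have hb := (h.mul h').add (h.const_mul ‖g‖)
  rw [zero_mul, mul_zero, add_zero] at hb
  refine squeeze_zero (fun _ => norm_nonneg _) (fun n => ?_) hb
  have e : InnerProductSpace.rankOne ℂ (γ n) (γ n) - InnerProductSpace.rankOne ℂ g g =
      InnerProductSpace.rankOne ℂ (γ n - g) (γ n) + InnerProductSpace.rankOne ℂ g (γ n - g) := by
    rw [map_sub, map_sub, sub_apply]
    abel
  rw [e]
  refine (norm_add_le _ _).trans_eq ?_
  rw [InnerProductSpace.norm_rankOne, InnerProductSpace.norm_rankOne]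

omit [CompleteSpace E] in
/-- The resolvent of the inverse of `O - a |g⟩⟨g|`, in terms of `m = O (1 - z O)⁻¹`. -/
theorem inverse_one_sub_smul_rankOneSub_apply {O m q : E →L[ℂ] E} {a z : ℂ} {g : E}
    (hu : IsUnit (1 - z • rankOneSub O a g)) (hq : q = 1 + z • m) (hm : O * q = m) (φ : E) :
    (Ring.inverse (1 - z • rankOneSub O a g) * rankOneSub O a g) φ =
      m φ - (a / (1 + a * z * inner ℂ g (q g)) * inner ℂ g (q φ)) • q g := by
  set W := 1 - z • rankOneSub O a g with hW
  have hWv : ∀ v, W v = v - z • (O v - (a * inner ℂ g v) • g) := fun v => by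
    rw [hW, sub_apply, smul_apply, rankOneSub_apply, one_apply_eq_self]
  have hqv : ∀ v, q v = v + z • m v := fun v => by
    rw [hq, add_apply, smul_apply, one_apply_eq_self]
  have hOq : ∀ v, O (q v) = m v := fun v => by rw [← mul_apply_eq_comp, hm]
  have hinv : ∀ v, Ring.inverse W (W v) = v := fun v => by
    rw [← mul_apply_eq_comp, Ring.inverse_mul_cancel _ hu, one_apply_eq_self]
  set D := 1 + a * z * inner ℂ g (q g) with hD
  have hWq : W (q g) = D • g := by
    rw [hWv, hOq, hD]
    conv_lhs => rw [hqv]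
    nth_rewrite 1 [hqv]
    module
  -- If `D = 0`, then `W (q g) = 0`, so `q g = 0` because `W` is invertible; but then `D = 1`.
  have hD0 : D ≠ 0 := by
    intro h0
    have h1 : q g = 0 := by rw [← hinv (q g), hWq, h0, zero_smul, map_zero]
    rw [hD, h1, inner_zero_right, mul_zero, add_zero] at h0
    exact one_ne_zero h0
  -- It suffices to apply `W` to the claimed value, as `W` is invertible.
  have key : W (m φ - (a / D * inner ℂ g (q φ)) • q g) = rankOneSub O a g φ := by
    rw [map_sub, map_smul, hWq, smul_smul, hWv, rankOneSub_apply]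
    have h1 : a / D * inner ℂ g (q φ) * D = a * inner ℂ g (q φ) := by field_simp
    have h2 : O φ = m φ - z • O (m φ) := by
      have := hOq φ
      rw [hqv, map_add, map_smul] at this
      exact eq_sub_of_add_eq this
    rw [h1, hqv, inner_add_right, inner_smul_right, h2]
    module
  rw [mul_apply_eq_comp, ← key, hinv]

end RankOne

/-! ### Multiplication operators on `L²` -/

section Multiplication

variable {X : Type*} [MeasurableSpace X] {μ : Measure X}

theorem _root_.MeasureTheory.MemLp.bdd_mul_of_ae_le {m : X → ℂ} (hm : AEStronglyMeasurable m μ)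
    {K : ℝ} (hK : ∀ᵐ x ∂μ, ‖m x‖ ≤ K) {φ : X → ℂ} (hφ : MemLp φ 2 μ) :
    MemLp (fun x => m x * φ x) 2 μ := by
  refine MemLp.of_le_mul (c := K) hφ (hm.mul hφ.1) ?_
  filter_upwards [hK] with x hx
  rw [norm_mul]
  gcongr

/-- `T` is the operator of multiplication by the function `m` on `L²(X, μ)`. -/
def IsMultiplication (μ : Measure X) (T : Lp ℂ 2 μ →L[ℂ] Lp ℂ 2 μ) (m : X → ℂ) : Prop :=
  ∀ φ : Lp ℂ 2 μ, T φ =ᵐ[μ] fun x => m x * φ x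

theorem exists_isMultiplication {m : X → ℂ} (hm : AEStronglyMeasurable m μ)
    {K : ℝ} (hK : ∀ᵐ x ∂μ, ‖m x‖ ≤ K) :
    ∃ T : Lp ℂ 2 μ →L[ℂ] Lp ℂ 2 μ, IsMultiplication μ T m := by
  have hmem : ∀ φ : Lp ℂ 2 μ, MemLp (fun x => m x * φ x) 2 μ := fun φ =>
    MemLp.bdd_mul_of_ae_le hm hK (Lp.memLp φ)
  let Tl : Lp ℂ 2 μ →ₗ[ℂ] Lp ℂ 2 μ :=
    { toFun := fun φ => (hmem φ).toLp _
      map_add' := by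
        intro φ ψ
        ext1
        filter_upwards [(hmem (φ + ψ)).coeFn_toLp, (hmem φ).coeFn_toLp, (hmem ψ).coeFn_toLp,
          Lp.coeFn_add φ ψ, Lp.coeFn_add ((hmem φ).toLp _) ((hmem ψ).toLp _)] with x h1 h2 h3 h4 h5
        rw [h1, h5, Pi.add_apply, h2, h3, h4, Pi.add_apply, mul_add]
      map_smul' := by
        intro c φ
        ext1
        filter_upwards [(hmem (c • φ)).coeFn_toLp, (hmem φ).coeFn_toLp,
          Lp.coeFn_smul c φ, Lp.coeFn_smul c ((hmem φ).toLp _)] with x h1 h2 h3 h4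
        rw [RingHom.id_apply, h1, h4, Pi.smul_apply, h2, h3, Pi.smul_apply, smul_eq_mul,
          smul_eq_mul, mul_left_comm] }
  refine ⟨Tl.mkContinuous K fun φ => ?_, fun φ => (hmem φ).coeFn_toLp⟩
  refine Lp.norm_le_mul_norm_of_ae_le_mul ?_
  filter_upwards [(hmem φ).coeFn_toLp, hK] with x h1 h2
  change ‖(hmem φ).toLp _ x‖ ≤ _
  rw [h1, norm_mul]
  gcongr

theorem IsMultiplication.isSelfAdjoint {T : Lp ℂ 2 μ →L[ℂ] Lp ℂ 2 μ} {m : X → ℝ}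
    (h : IsMultiplication μ T fun x => (m x : ℂ)) : IsSelfAdjoint T := by
  rw [ContinuousLinearMap.isSelfAdjoint_iff_isSymmetric]
  intro φ ψ
  change (inner ℂ (T φ) ψ : ℂ) = inner ℂ φ (T ψ)
  rw [L2.inner_def, L2.inner_def]
  refine integral_congr_ae ?_
  filter_upwards [h φ, h ψ] with x h1 h2
  rw [h1, h2, RCLike.inner_apply, RCLike.inner_apply, map_mul, Complex.conj_ofReal]
  ring

theorem IsMultiplication.mul {S T R : Lp ℂ 2 μ →L[ℂ] Lp ℂ 2 μ} {m k l : X → ℂ}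
    (hS : IsMultiplication μ S m) (hT : IsMultiplication μ T k) (hR : IsMultiplication μ R l)
    (h : ∀ᵐ x ∂μ, m x * k x = l x) : S * T = R := by
  ext φ : 1
  ext1
  filter_upwards [hS (T φ), hT φ, hR φ, h] with x h1 h2 h3 h4
  rw [mul_apply_eq_comp, h1, h2, h3, ← h4, mul_assoc]

theorem IsMultiplication.injective {T : Lp ℂ 2 μ →L[ℂ] Lp ℂ 2 μ} {m : X → ℂ}
    (hT : IsMultiplication μ T m) (h : ∀ᵐ x ∂μ, m x ≠ 0) (φ : Lp ℂ 2 μ) (hφ : T φ = 0) :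
    φ = 0 := by
  ext1
  have h1 := hT φ
  rw [hφ] at h1
  filter_upwards [h1, h, Lp.coeFn_zero ℂ 2 μ] with x h1 h2 h3
  rw [h3, Pi.zero_apply] at h1 ⊢
  exact (mul_eq_zero.1 h1.symm).resolve_left h2

theorem IsMultiplication.isResolventAt_mulOp {O : Lp ℂ 2 μ →L[ℂ] Lp ℂ 2 μ} {w : X → ℝ}
    (hO : IsMultiplication μ O fun x => (w x : ℂ)⁻¹) (h : ∀ᵐ x ∂μ, w x ≠ 0) :
    IsResolventAt (mulOp μ w) 0 O := by
  rw [isResolventAt_iff]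
  intro x y
  rw [zero_smul, sub_zero, LinearPMap.mem_graph_iff]
  constructor
  · rintro ⟨φ, rfl, rfl⟩
    ext1
    filter_upwards [hO (mulOp μ w φ), MemLp.coeFn_toLp φ.2, h] with t h1 h2 h3
    rw [h1]
    change _ = (w t : ℂ)⁻¹ * (MemLp.toLp _ φ.2) t
    rw [h2, inv_mul_cancel_left₀ (Complex.ofReal_ne_zero.2 h3)]
  · intro hx
    have hae : (fun t => (w t : ℂ) * x t) =ᵐ[μ] y := by
      filter_upwards [hO y, h] with t h1 h3
      rw [hx, h1, mul_inv_cancel_left₀ (Complex.ofReal_ne_zero.2 h3)]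
    have hmem : MemLp (fun t => (w t : ℂ) * x t) 2 μ := (Lp.memLp y).ae_eq hae.symm
    refine ⟨⟨x, hmem⟩, rfl, ?_⟩
    change MemLp.toLp _ hmem = y
    ext1
    exact hmem.coeFn_toLp.trans hae

/-- Dominated convergence with dominating function `|g|²`; pointwise the difference vanishes as soon
as `n ≥ ω x`. -/
theorem tendsto_Lp_of_ae_eq_indicator {ω : X → ℝ} {g : Lp ℂ 2 μ} {γ : ℕ → Lp ℂ 2 μ}
    (h : ∀ n, γ n =ᵐ[μ] {x | ω x ≤ n}.indicator g) : Tendsto γ atTop (𝓝 g) := by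
  have hd : ∀ n, ∀ᵐ x ∂μ, (γ n - g) x = {x | ω x ≤ n}.indicator g x - g x := fun n => by
    filter_upwards [h n, Lp.coeFn_sub (γ n) g] with x h1 h2
    rw [h2, Pi.sub_apply, h1]
  have h0 : Tendsto (fun n => (inner ℂ (γ n - g) (γ n - g) : ℂ)) atTop (𝓝 0) := by
    simp only [L2.inner_def]
    rw [← integral_zero X ℂ (μ := μ)]
    refine tendsto_integral_of_dominated_convergence (fun x => ‖(inner ℂ (g x) (g x) : ℂ)‖)
      (fun n => (L2.integrable_inner (𝕜 := ℂ) (γ n - g) (γ n - g)).1)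
      (L2.integrable_inner (𝕜 := ℂ) g g).norm (fun n => ?_) ?_
    · filter_upwards [hd n] with x hx
      rw [hx]
      by_cases hxn : x ∈ {x | ω x ≤ n}
      · simp [Set.indicator_of_mem hxn]
      · simp [Set.indicator_of_notMem hxn]
    · filter_upwards [ae_all_iff.2 hd] with x hx
      obtain ⟨N, hN⟩ := exists_nat_ge (ω x)
      refine tendsto_const_nhds.congr' ?_
      filter_upwards [eventually_ge_atTop N] with n hn
      have hxn : x ∈ {x | ω x ≤ n} := hN.trans (Nat.cast_le.2 hn)
      rw [hx, Set.indicator_of_mem hxn, sub_self, inner_zero_left]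
  rw [tendsto_iff_norm_sub_tendsto_zero]
  have h1 := h0.norm.sqrt
  rw [norm_zero, Real.sqrt_zero] at h1
  refine h1.congr fun n => ?_
  rw [inner_self_eq_norm_sq_to_K, norm_pow, RCLike.norm_ofReal, abs_norm,
    Real.sqrt_sq (norm_nonneg _)]

end Multiplication

/-! ### The weights `ω^s`, the renormalized resolvent and the cut-off operator -/

section Weights

variable {X : Type*} [MeasurableSpace X] {μ : Measure X} {ω : X → ℝ} {f : X → ℂ}

/-- This and the next identity express every weighted occurrence of `f` through `g = ω^{-3/2} f`,
the vector known to lie in `L²`. -/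
theorem rpow_half_eq {w : ℝ} (hw : 1 ≤ w) :
    w ^ (1 / 2 : ℝ) = w ^ 2 * w ^ (-(3 / 2) : ℝ) := by
  rw [← Real.rpow_natCast, ← Real.rpow_add (by linarith)]
  norm_num

theorem rpow_neg_one_eq {w : ℝ} (hw : 1 ≤ w) :
    w ^ (-1 : ℝ) = w ^ 2 * (w ^ (-(3 / 2) : ℝ) * w ^ (-(3 / 2) : ℝ)) := by
  rw [← Real.rpow_natCast, ← Real.rpow_add (by linarith), ← Real.rpow_add (by linarith)]
  norm_num

theorem memLp_wpow_half_cutoff (hω : Measurable ω) (hω_ge : ∀ᵐ x ∂μ, 1 ≤ ω x)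
    (hf : MemLp (wpow ω (-(3 / 2)) f) 2 μ) (n : ℕ) :
    MemLp (wpow ω (1 / 2) (cutoff ω n f)) 2 μ := by
  have hs : MeasurableSet {x | ω x ≤ n} := measurableSet_le hω measurable_const
  have hm : Measurable ({x | ω x ≤ n}.indicator fun x => ((ω x : ℂ) ^ 2)) :=
    ((Complex.measurable_ofReal.comp hω).pow_const 2).indicator hs
  have hb : ∀ᵐ x ∂μ, ‖{x | ω x ≤ n}.indicator (fun x => ((ω x : ℂ) ^ 2)) x‖ ≤ (n : ℝ) ^ 2 := by
    filter_upwards [hω_ge] with x hx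
    by_cases hxn : x ∈ {x | ω x ≤ n}
    · rw [Set.indicator_of_mem hxn, norm_pow, Complex.norm_real, Real.norm_eq_abs,
        abs_of_nonneg (by linarith)]
      have : ω x ≤ n := hxn
      gcongr
    · rw [Set.indicator_of_notMem hxn, norm_zero]
      positivity
  refine (MemLp.bdd_mul_of_ae_le hm.aestronglyMeasurable hb hf).ae_eq ?_
  filter_upwards [hω_ge] with x hx
  by_cases hxn : x ∈ {x | ω x ≤ n}
  · rw [wpow, wpow, cutoff, Set.indicator_of_mem hxn, Set.indicator_of_mem hxn, rpow_half_eq hx]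
    push_cast
    ring
  · rw [wpow, wpow, cutoff, Set.indicator_of_notMem hxn, Set.indicator_of_notMem hxn, zero_mul, mul_zero]

theorem exists_isMultiplication_inv (hω : Measurable ω) (hω_ge : ∀ᵐ x ∂μ, 1 ≤ ω x) :
    ∃ P : Lp ℂ 2 μ →L[ℂ] Lp ℂ 2 μ, IsMultiplication μ P fun x => (((ω x)⁻¹ : ℝ) : ℂ) := by
  refine exists_isMultiplication (K := 1)
    (Complex.measurable_ofReal.comp hω.inv).aestronglyMeasurable ?_
  filter_upwards [hω_ge] with x hx
  rw [Complex.norm_real, Real.norm_eq_abs, abs_of_nonneg (by positivity)]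
  exact inv_le_one_of_one_le₀ hx

theorem isMultiplication_mul_inv {P : Lp ℂ 2 μ →L[ℂ] Lp ℂ 2 μ}
    (hP : IsMultiplication μ P fun x => (((ω x)⁻¹ : ℝ) : ℂ)) :
    IsMultiplication μ (P * P) fun x => ((ω x ^ 2 : ℝ) : ℂ)⁻¹ := by
  intro φ
  filter_upwards [hP (P φ), hP φ] with x h1 h2
  rw [mul_apply_eq_comp, h1, h2]
  push_cast
  ring

theorem sub_ne_zero_of_im_ne_zero {z : ℂ} (hz : z.im ≠ 0) (w : ℝ) : (w : ℂ) ^ 2 - z ≠ 0 := by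
  intro h
  apply hz
  rw [← sub_eq_zero.1 h, ← Complex.ofReal_pow, Complex.ofReal_im]

theorem exists_isMultiplication_resolvent (hω : Measurable ω) {z : ℂ} (hz : z.im ≠ 0) :
    ∃ m : Lp ℂ 2 μ →L[ℂ] Lp ℂ 2 μ, IsMultiplication μ m fun x => ((ω x : ℂ) ^ 2 - z)⁻¹ := by
  refine exists_isMultiplication (K := |z.im|⁻¹) (((Complex.measurable_ofReal.comp hω).pow_const
    2).sub_const z).inv.aestronglyMeasurable (Eventually.of_forall fun x => ?_)
  rw [norm_inv]
  have h1 : ((ω x : ℂ) ^ 2 - z).im = -z.im := by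
    rw [Complex.sub_im, ← Complex.ofReal_pow, Complex.ofReal_im, zero_sub]
  have h2 := Complex.abs_im_le_norm ((ω x : ℂ) ^ 2 - z)
  rw [h1, abs_neg] at h2
  exact inv_anti₀ (abs_pos.2 hz) h2

/-- The bounded inverse `ω⁻² - 4 κ |g⟩⟨g|` determines the renormalized resolvent of
`f = ω^{3/2} g`. -/
theorem renormalizedResolvent_ae_eq (hω : Measurable ω) (hω_ge : ∀ᵐ x ∂μ, 1 ≤ ω x)
    (hf : MemLp (wpow ω (-(3 / 2)) f) 2 μ) {O : Lp ℂ 2 μ →L[ℂ] Lp ℂ 2 μ}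
    (hO : IsMultiplication μ O fun x => ((ω x ^ 2 : ℝ) : ℂ)⁻¹) (κ : ℝ) {z : ℂ} (hz : z.im ≠ 0)
    (hu : IsUnit (1 - z • rankOneSub O ((4 * κ : ℝ) : ℂ) (hf.toLp _))) (φ : Lp ℂ 2 μ) :
    (Ring.inverse (1 - z • rankOneSub O ((4 * κ : ℝ) : ℂ) (hf.toLp _)) *
      rankOneSub O ((4 * κ : ℝ) : ℂ) (hf.toLp _)) φ =ᵐ[μ] renormalizedResolvent μ ω f κ z φ := by
  obtain ⟨m, hm⟩ := exists_isMultiplication_resolvent (μ := μ) hω hz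
  set g := hf.toLp _ with hg
  have hgae : g =ᵐ[μ] wpow ω (-(3 / 2)) f := hf.coeFn_toLp
  -- With `m = (ω² - z)⁻¹`, the operator `q = 1 + z m` is multiplication by `ω² (ω² - z)⁻¹`; its
  -- factor `ω²` turns `ω^{-3/2} f` into `ω^{1/2} f`.
  have hq : ∀ ψ : Lp ℂ 2 μ, (1 + z • m) ψ =ᵐ[μ]
      fun x => (ω x : ℂ) ^ 2 * (((ω x : ℂ) ^ 2 - z)⁻¹ * ψ x) := by
    intro ψ
    filter_upwards [hm ψ, Lp.coeFn_add ψ (z • m ψ), Lp.coeFn_smul z (m ψ)] with x h1 h2 h3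
    rw [add_apply, one_apply_eq_self, smul_apply, h2, Pi.add_apply, h3, Pi.smul_apply, h1,
      smul_eq_mul]
    have := sub_ne_zero_of_im_ne_zero hz (ω x)
    field_simp
    ring
  have hOq : O * (1 + z • m) = m := by
    ext ψ : 1
    ext1
    filter_upwards [hO ((1 + z • m) ψ), hq ψ, hm ψ, hω_ge] with x h1 h2 h3 h4
    rw [mul_apply_eq_comp, h1, h2, h3, Complex.ofReal_pow, inv_mul_cancel_left₀]
    exact pow_ne_zero 2 (Complex.ofReal_ne_zero.2 (by linarith))
  rw [inverse_one_sub_smul_rankOneSub_apply hu rfl hOq]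
  have hp₁ : (inner ℂ g ((1 + z • m) g) : ℂ) =
      pairing μ f (wpow ω (-1) fun y => ((ω y : ℂ) ^ 2 - z)⁻¹ * f y) := by
    rw [L2.inner_def, pairing]
    refine integral_congr_ae ?_
    filter_upwards [hq g, hgae, hω_ge] with x h1 h2 h3
    rw [RCLike.inner_apply', h1, h2, wpow, wpow, rpow_neg_one_eq h3, map_mul, Complex.conj_ofReal]
    push_cast
    ring
  have hp₂ : (inner ℂ g ((1 + z • m) φ) : ℂ) =
      pairing μ f (wpow ω (1 / 2) fun y => ((ω y : ℂ) ^ 2 - z)⁻¹ * φ y) := by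
    rw [L2.inner_def, pairing]
    refine integral_congr_ae ?_
    filter_upwards [hq φ, hgae, hω_ge] with x h1 h2 h3
    rw [RCLike.inner_apply', h1, h2, wpow, wpow, rpow_half_eq h3, map_mul, Complex.conj_ofReal]
    push_cast
    ring
  rw [hp₁, hp₂]
  set c₁ := pairing μ f (wpow ω (-1) fun y => ((ω y : ℂ) ^ 2 - z)⁻¹ * f y) with hc₁
  set c₂ := pairing μ f (wpow ω (1 / 2) fun y => ((ω y : ℂ) ^ 2 - z)⁻¹ * φ y) with hc₂
  set c := ((4 * κ : ℝ) : ℂ) / (1 + ((4 * κ : ℝ) : ℂ) * z * c₁) * c₂ with hc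
  filter_upwards [hm φ, hq g, hgae, hω_ge, Lp.coeFn_sub (m φ) (c • (1 + z • m) g),
    Lp.coeFn_smul c ((1 + z • m) g)] with x h1 h2 h3 h4 h5 h6
  rw [h5, Pi.sub_apply, h6, Pi.smul_apply, h1, h2, h3, renormalizedResolvent, ← hc₁, ← hc₂, wpow,
    wpow, rpow_half_eq h4, hc, smul_eq_mul]
  push_cast
  ring

/-- The operator in the definition of `ξ` is pinned down by its resolvent at one point, for which `z
= i` is used; it is the operator with bounded inverse `ω⁻² - 4κ |g⟩⟨g|`. -/
theorem isRenormalizedXi_iff (hω : Measurable ω) (hω_ge : ∀ᵐ x ∂μ, 1 ≤ ω x)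
    (hf : MemLp (wpow ω (-(3 / 2)) f) 2 μ) {O : Lp ℂ 2 μ →L[ℂ] Lp ℂ 2 μ}
    (hO : IsMultiplication μ O fun x => ((ω x ^ 2 : ℝ) : ℂ)⁻¹) {κ : ℝ}
    {A : Lp ℂ 2 μ →ₗ.[ℂ] Lp ℂ 2 μ}
    (hA : IsResolventAt A 0 (rankOneSub O ((4 * κ : ℝ) : ℂ) (hf.toLp _)))
    (hB : IsSelfAdjoint (rankOneSub O ((4 * κ : ℝ) : ℂ) (hf.toLp _)))
    (ξ : Lp ℂ 2 μ →ₗ.[ℂ] Lp ℂ 2 μ) :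
    IsRenormalizedXi μ ω f κ ξ ↔ IsPositiveSqrt ξ A := by
  have hA' : IsResolventAt A ((0 : ℝ) : ℂ) (rankOneSub O ((4 * κ : ℝ) : ℂ) (hf.toLp _)) := by
    simpa using hA
  have hR : ∀ z : ℂ, z.im ≠ 0 → ∃ R : Lp ℂ 2 μ →L[ℂ] Lp ℂ 2 μ, IsResolventAt A z R ∧
      ∀ φ : Lp ℂ 2 μ, R φ =ᵐ[μ] renormalizedResolvent μ ω f κ z φ := by
    intro z hz
    have h1 := hA'.of_im_ne_zero hB hz
    rw [Complex.ofReal_zero, sub_zero] at h1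
    exact ⟨_, h1, renormalizedResolvent_ae_eq hω hω_ge hf hO κ hz (isUnit_one_sub_smul hB hz)⟩
  constructor
  · rintro ⟨A', -, hA'', hξ⟩
    obtain ⟨R, hR1, hR2⟩ := hR Complex.I (by simp)
    obtain ⟨R', hR1', hR2'⟩ := hA'' Complex.I (by simp)
    have : R' = R := by
      ext φ : 1
      ext1
      exact (hR2' φ).trans (hR2 φ).symm
    subst this
    rwa [hR1.eq hR1']
  · intro h
    exact ⟨A, hA'.isSelfAdjoint hB, hR, h⟩

/-- The cut-off operator has the bounded inverse `ω⁻² - 4 κ |gₙ⟩⟨gₙ|`, with the renormalized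
coupling constant `κ`. -/
theorem isResolventAt_rankOnePerturbation (hω_ge : ∀ᵐ x ∂μ, 1 ≤ ω x)
    {P : Lp ℂ 2 μ →L[ℂ] Lp ℂ 2 μ} (hP : IsMultiplication μ P fun x => (((ω x)⁻¹ : ℝ) : ℂ))
    {κ κ' : ℝ} (hκ : κ < 0) {g : X → ℂ} (hg : MemLp (wpow ω (1 / 2) g) 2 μ)
    (h : ((κ'⁻¹ : ℝ) : ℂ) = ((κ⁻¹ : ℝ) : ℂ) - 4 * pairing μ g (wpow ω (-1) g)) :
    IsResolventAt (rankOnePerturbation μ ω κ' (hg.toLp _)) 0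
      (rankOneSub (P * P) ((4 * κ : ℝ) : ℂ) ((P * P) (hg.toLp _))) := by
  set ψ := hg.toLp _ with hψ
  have hψae : ψ =ᵐ[μ] wpow ω (1 / 2) g := hg.coeFn_toLp
  have hO := isMultiplication_mul_inv hP
  have hPs := hP.isSelfAdjoint
  have hc : (inner ℂ ψ ((P * P) ψ) : ℂ) = pairing μ g (wpow ω (-1) g) := by
    rw [L2.inner_def, pairing]
    refine integral_congr_ae ?_
    filter_upwards [hO ψ, hψae, hω_ge] with x h1 h2 h3
    rw [RCLike.inner_apply', h1, h2, wpow, wpow, rpow_half_eq h3, rpow_neg_one_eq h3, map_mul,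
      Complex.conj_ofReal]
    have : (ω x : ℂ) ≠ 0 := Complex.ofReal_ne_zero.2 (by linarith)
    push_cast
    field_simp
  have hc' : (inner ℂ ψ ((P * P) ψ) : ℂ) = ((‖P ψ‖ ^ 2 : ℝ) : ℂ) := by
    rw [mul_apply_eq_comp, ← hPs.inner_symm, inner_self_eq_norm_sq_to_K]
    push_cast
    rfl
  set c : ℝ := ‖P ψ‖ ^ 2 with hcdef
  have hc0 : 0 ≤ c := sq_nonneg _
  -- The pairing is the real number `c = ‖ω⁻¹ψ‖² ≥ 0`, so the renormalization condition is an
  -- equation between reals.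
  have hreal : κ'⁻¹ = κ⁻¹ - 4 * c := by
    rw [← hc, hc'] at h
    exact_mod_cast h
  have hneg : κ'⁻¹ < 0 := by
    have := inv_lt_zero.2 hκ
    linarith
  -- Nonvanishing excludes the convention `0⁻¹ = 0`, so the condition can be cleared of inverses.
  have hκ' : κ' ≠ 0 := (inv_lt_zero.1 hneg).ne
  -- Both scalar conditions of Sherman–Morrison, with `a = 4κ` and `b = 4κ'`, are multiples of this
  -- relation.
  have hrel : κ = κ' * (1 - 4 * κ * c) := by
    have hκ0 := hκ.ne
    have h1 : κ * κ' * κ'⁻¹ = κ * κ' * (κ⁻¹ - 4 * c) := by rw [hreal]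
    rw [mul_assoc, mul_inv_cancel₀ hκ', mul_sub, mul_comm κ κ', mul_assoc,
      mul_inv_cancel₀ hκ0] at h1
    linear_combination h1
  have hrelC : (κ : ℂ) = κ' * (1 - 4 * κ * c) := by exact_mod_cast hrel
  refine IsResolventAt.vadd_rankOne (hO.isResolventAt_mulOp ?_) ?_ ψ ?_ ?_
  · filter_upwards [hω_ge] with x hx
    exact pow_ne_zero 2 (by linarith)
  · rw [← sq]
    exact hPs.pow 2
  · rw [hc']
    push_cast
    linear_combination 4 * hrelC
  · rw [hc']
    push_cast
    linear_combination (-4) * hrelC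

end Weights

end QuadBose

end

/-! ### The main theorem -/

theorem mainTheorem7 {X : Type*} [MeasurableSpace X] (μ : MeasureTheory.Measure X)
    (ω : X → ℝ) (hω : Measurable ω) (hω_ge : ∀ᵐ x ∂μ, 1 ≤ ω x)
    (f : X → ℂ)
    (hf_irregular : ¬ MeasureTheory.MemLp (QuadBose.wpow ω (-(1 / 2)) f) 2 μ)
    (hf : MeasureTheory.MemLp (QuadBose.wpow ω (-(3 / 2)) f) 2 μ)
    (lam : ℝ) (hlam : lam < 0)
    (lamSeq : ℕ → ℝ)
    (hlamSeq : ∀ n : ℕ, (((lamSeq n)⁻¹ : ℝ) : ℂ) = ((lam⁻¹ : ℝ) : ℂ) -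
      4 * QuadBose.pairing μ (QuadBose.cutoff ω n f)
        (QuadBose.wpow ω (-1) (QuadBose.cutoff ω n f))) :
    (∀ n : ℕ, ∃! ξ : MeasureTheory.Lp ℂ 2 μ →ₗ.[ℂ] MeasureTheory.Lp ℂ 2 μ,
      QuadBose.IsXi μ ω (QuadBose.cutoff ω n f) (lamSeq n) ξ) ∧
    (∃! ξ : MeasureTheory.Lp ℂ 2 μ →ₗ.[ℂ] MeasureTheory.Lp ℂ 2 μ,
      QuadBose.IsRenormalizedXi μ ω f lam ξ) ∧
    ∀ (ξSeq : ℕ → MeasureTheory.Lp ℂ 2 μ →ₗ.[ℂ] MeasureTheory.Lp ℂ 2 μ)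
      (ξ : MeasureTheory.Lp ℂ 2 μ →ₗ.[ℂ] MeasureTheory.Lp ℂ 2 μ),
      (∀ n : ℕ, QuadBose.IsXi μ ω (QuadBose.cutoff ω n f) (lamSeq n) (ξSeq n)) →
      QuadBose.IsRenormalizedXi μ ω f lam ξ →
      QuadBose.NormResolventTendsto (fun n => QuadBose.dGamma (ξSeq n)) (QuadBose.dGamma ξ) := by
  open QuadBose in
  obtain ⟨P, hP⟩ := exists_isMultiplication_inv hω hω_ge
  have hPs := hP.isSelfAdjoint
  have hP0 := hP.injective <| by
    filter_upwards [hω_ge] with x hx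
    exact Complex.ofReal_ne_zero.2 (inv_ne_zero (by linarith))
  have hO := isMultiplication_mul_inv hP
  have hψ := memLp_wpow_half_cutoff hω hω_ge hf
  have h4 : 4 * lam ≤ 0 := by linarith
  have hpos : ∀ g, 0 ≤ rankOneSub (P * P) ((4 * lam : ℝ) : ℂ) g := rankOneSub_nonneg hPs rfl h4
  have hA := fun n => isResolventAt_rankOnePerturbation hω_ge hP hlam (hψ n) (hlamSeq n)
  obtain ⟨A, hA'⟩ := exists_isResolventAt 0 (rankOneSub (P * P) ((4 * lam : ℝ) : ℂ) (hf.toLp _))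
    (rankOneSub_injective hPs rfl hP0 h4 _)
  have hiff := isRenormalizedXi_iff hω hω_ge hf hO hA'
    ((ContinuousLinearMap.nonneg_iff_isPositive _).1 (hpos _)).isSelfAdjoint
  have hiff' : ∀ n ξ, IsXi μ ω (cutoff ω n f) (lamSeq n) ξ ↔
      IsPositiveSqrt ξ (rankOnePerturbation μ ω (lamSeq n) ((hψ n).toLp _)) := fun n ξ =>
    ⟨fun ⟨_, h⟩ => h, fun h => ⟨hψ n, h⟩⟩
  refine ⟨fun n => ?_, ?_, fun ξSeq ξ hξSeq hξ => ?_⟩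
  · simp only [hiff']
    exact existsUnique_isPositiveSqrt (hA n) (hpos _)
  · simp only [hiff]
    exact existsUnique_isPositiveSqrt hA' (hpos _)
  · refine normResolventTendsto_dGamma
      (fun n => ((hiff' n _).1 (hξSeq n)).isResolventAt (hA n)) (((hiff ξ).1 hξ).isResolventAt hA')
      (fun n => CFC.sqrt_nonneg _) (CFC.sqrt_nonneg _) ?_
    -- The rank-one vectors of the inverses are `ω⁻² ω^{1/2} fₙ = 1_{ω ≤ n} ω^{-3/2} f`, truncations
    -- of a fixed `L²` vector.
    have hlim : Filter.Tendsto (fun n => (P * P) ((hψ n).toLp _)) Filter.atTop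
        (nhds (hf.toLp (wpow ω (-(3 / 2)) f))) := by
      refine tendsto_Lp_of_ae_eq_indicator (ω := ω) fun n => ?_
      filter_upwards [hO ((hψ n).toLp _), (hψ n).coeFn_toLp, hf.coeFn_toLp, hω_ge] with x h1 h2 h3 h5
      rw [h1, h2, wpow, cutoff]
      by_cases hx : x ∈ {x | ω x ≤ n}
      · rw [Set.indicator_of_mem hx, Set.indicator_of_mem hx, h3, wpow, rpow_half_eq h5]
        have : (ω x : ℂ) ≠ 0 := Complex.ofReal_ne_zero.2 (by linarith)
        push_cast
        field_simp
      · rw [Set.indicator_of_notMem hx, Set.indicator_of_notMem hx, mul_zero, mul_zero]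
    exact tendsto_cfcSqrt (fun _ => hpos _) (hpos _) (tendsto_rankOneSub (P * P) _ hlim)
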